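/- Let $H^4=\{x\in\mathbb R^{4,1}:\langle x,x\rangle=-1,\ x_5>0\}$, where $\langle x,y\rangle=x_1y_1+\dots+x_4y_4-x_5y_5$, and let $\mathrm{SO}^+(4,1)$ be the group of real $5\times5$ matrices of determinant $1$ that preserve $\langle\cdot,\cdot\rangle$ and map $H^4$ to itself. Let $J=\mathrm{diag}(1,-1)$ and let $\mathrm{SU}(1,1;\mathbb H)=\{A\in\mathbb H(2):A^*JA=J\}$. For $x\in\mathbb R^5$ put $H(x)=\begin{pmatrix}x_5&v\\ \bar v&x_5\end{pmatrix}$ with $v=x_1+x_2\mathbf i+x_3\mathbf j+x_4\mathbf k$, and let $\eta:\mathrm{SU}(1,1;\mathbb H)\to\mathrm{SO}^+(4,1)$ be the double covering defined by $H(\eta(A)x)=A\,H(x)\,A^*$; it represents $\mathrm{Spin}^+(4,1)\to\mathrm{SO}^+(4,1)$. Let $\mathrm{Spin}(4)\subset \mathrm{SU}(1,1;\mathbb H)$ be the preimage under $\eta$ of the stabilizer of $e_5$. Let $\Gamma\subset\mathrm{SO}^+(4,1)$ be a discrete subgroup acting freely on $H^4$ with $M=\Gamma\backslash H^4$ compact,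 and let $\hat\Gamma\subset\mathrm{SU}(1,1;\mathbb H)$ be a subgroup mapped bijectively onto $\Gamma$ by $\eta$, so that $\hat\Gamma\backslash\mathrm{SU}(1,1;\mathbb H)$, with the projection $\hat\Gamma\hat g\mapsto\Gamma(\eta(\hat g)e_5)$ and the right action of $\mathrm{Spin}(4)$, is a spin structure on $M$. For $f$ normalizing $\Gamma$ and $\hat f$ normalizing $\hat\Gamma$ write $f_\star(\Gamma x)=\Gamma fx$ and $\hat f_\star(\hat\Gamma\hat g)=\hat\Gamma\hat f\hat g$. If $\eta(\hat f)=f$, then $\hat f_\star$ is a symmetry of the spin structure that is a lift of the orientation-preserving isometry $f_\star$ of $M$. Let $\Delta_4$ be the complex spin representation of $\mathrm{Spin}(4)$ on $\mathbb C^4$, obtained from the embedding of $\mathbb H(2)$ in $\mathbb C(4)$ induced by $a+b\mathbf j\mapsto\begin{pmatrix}a&b\\-\bar b&\bar a\end{pmatrix}$ ($a,b\in\mathbb C$), with Clifford multiplication by $x\in\mathbb R^{4,1}$ given by $-H(x)J$, and let $\Delta_4^\pm$ be its restrictions to the $\pm1$ eigenspaces of $\mathbf i^2e_1e_2e_3e_4$.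 If $P$ is an isolated fixed point of $\phi=f_\star$ and $\hat\phi=\hat f_\star$ is a lift of $\phi$, the contribution of $P$ to the $G$-index $\mathrm{Spin}(\hat\phi,M)$ is $$\nu(\hat\phi,P)=\frac{\mathrm{tr}(\hat\phi\,|\,S_P^+)-\mathrm{tr}(\hat\phi\,|\,S_P^-)}{|\det(I-d\phi_P)|},$$ where $S^\pm_P$ is the fibre at $P$ of the bundle of positive (respectively negative) spinors, which is associated to the spin structure by $\Delta_4^\pm$, and $\hat\phi$ acts on it in the natural way. **Theorem.** Let $\phi$ be an orientation-preserving isometry of $M$, and let $\hat\phi$ be a lift of $\phi$ to a symmetry of the spin structure $\hat\Gamma\backslash\mathrm{SU}(1,1;\mathbb H)$. Let $f\in\mathrm{SO}^+(4,1)$ be such that $\phi=f_\star$, and let $\hat f\in\mathrm{SU}(1,1;\mathbb H)$ be the lift of $f$ such that $\hat\phi=\hat f_\star$. Let $P$ be an isolated fixed point of $\phi$, let $x\in H^4$ be such that $\Gamma x=P$, let $g\in\mathrm{SO}^+(4,1)$ be such that $ge_5=x$, and let $\hat g\in\mathrm{SU}(1,1;\mathbb H)$ be a lift of $g$. Let $\gamma$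 be the unique element of $\Gamma$ such that $\gamma fx=x$, and let $\hat\gamma$ be the unique element of $\hat\Gamma$ that lifts $\gamma$. Then $\hat g^{-1}\hat\gamma\hat f\hat g=\mathrm{diag}(p,q)$ with $p$ and $q$ unit quaternions, $\mathrm{Re}(p)\ne\mathrm{Re}(q)$, and $$\nu(\hat\phi,P)=\frac{1}{2(\mathrm{Re}(p)-\mathrm{Re}(q))}.$$ -/

import Mathlib

open scoped Quaternion Topology Matrix

noncomputable section

namespace SpinHyp

/-- The diagonal matrix `diag(1, -1)` over the quaternions. -/
def Jmat : Matrix (Fin 2) (Fin 2) ℍ[ℝ] := !![1, 0; 0, -1]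

/-- `SU(1,1;ℍ)`, the group of quaternionic matrices with `A* J A = J`. (Every such matrix is
invertible, so it is no restriction to work inside the group of units.) -/
def SU11 : Subgroup (Matrix (Fin 2) (Fin 2) ℍ[ℝ])ˣ where
  carrier := {A | (A : Matrix (Fin 2) (Fin 2) ℍ[ℝ])ᴴ * Jmat * A = Jmat}
  mul_mem' := by
    intro A B hA hB
    simp only [Set.mem_ofPred_eq] at hA hB ⊢
    rw [Units.val_mul, Matrix.conjTranspose_mul]
    calc _ = (B : Matrix (Fin 2) (Fin 2) ℍ[ℝ])ᴴ *
          ((A : Matrix (Fin 2) (Fin 2) ℍ[ℝ])ᴴ * Jmat * A) * B := by simp only [mul_assoc]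
      _ = Jmat := by rw [hA, hB]
  one_mem' := by simp
  inv_mem' := by
    intro A hA
    simp only [Set.mem_ofPred_eq] at hA ⊢
    have h1 : (A : Matrix (Fin 2) (Fin 2) ℍ[ℝ]) * (A⁻¹ : (Matrix (Fin 2) (Fin 2) ℍ[ℝ])ˣ) = 1 :=
      A.mul_inv
    have h2 := congrArg Matrix.conjTranspose h1
    rw [Matrix.conjTranspose_mul, Matrix.conjTranspose_one] at h2
    generalize ((A⁻¹ : (Matrix (Fin 2) (Fin 2) ℍ[ℝ])ˣ) : Matrix (Fin 2) (Fin 2) ℍ[ℝ]) = B at *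
    calc Bᴴ * Jmat * B = Bᴴ * ((A : Matrix (Fin 2) (Fin 2) ℍ[ℝ])ᴴ * Jmat * A) * B := by rw [hA]
      _ = (Bᴴ * (A : Matrix (Fin 2) (Fin 2) ℍ[ℝ])ᴴ) * Jmat * (A * B) := by
          simp only [mul_assoc]
      _ = Jmat := by rw [h1, h2]; simp

theorem Jmat_sq : Jmat * Jmat = 1 := by
  ext i j <;> fin_cases i <;> fin_cases j <;> simp [Jmat]

/-- The matrix underlying an element of `SU(1,1;ℍ)`. -/
abbrev mat (A : SU11) : Matrix (Fin 2) (Fin 2) ℍ[ℝ] := ↑(↑A : (Matrix (Fin 2) (Fin 2) ℍ[ℝ])ˣ)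

theorem star_mat_mul (A : SU11) : (mat A)ᴴ * Jmat * mat A = Jmat := A.2

theorem mat_mul_star (A : SU11) : mat A * Jmat * (mat A)ᴴ = Jmat := by
  have h : (Jmat * (mat A)ᴴ * Jmat) * mat A = 1 := by
    rw [mul_assoc, mul_assoc, ← mul_assoc _ Jmat, star_mat_mul, Jmat_sq]
  have h' : mat A * (Jmat * (mat A)ᴴ * Jmat) = 1 := by
    rw [← Units.inv_eq_of_mul_eq_one_left h]
    exact A.1.mul_inv
  calc mat A * Jmat * (mat A)ᴴ = mat A * (Jmat * (mat A)ᴴ * Jmat) * Jmat := by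
        simp only [mul_assoc, Jmat_sq, mul_one]
    _ = Jmat := by rw [h', one_mul]

/-- The quaternion `r + s i + t j + u k`. -/
def quat (r s t u : ℝ) : ℍ[ℝ] := ⟨r, s, t, u⟩

@[simp] theorem quat_re (r s t u : ℝ) : (quat r s t u).re = r := rfl
@[simp] theorem quat_imI (r s t u : ℝ) : (quat r s t u).imI = s := rfl
@[simp] theorem quat_imJ (r s t u : ℝ) : (quat r s t u).imJ = t := rfl
@[simp] theorem quat_imK (r s t u : ℝ) : (quat r s t u).imK = u := rfl

/-- The Hermitian matrix with diagonal entries `x₅` and upper right entry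
`x₁ + x₂ i + x₃ j + x₄ k`. -/
def herm (x : Fin 5 → ℝ) : Matrix (Fin 2) (Fin 2) ℍ[ℝ] :=
  !![quat (x 4) 0 0 0, quat (x 0) (x 1) (x 2) (x 3);
     star (quat (x 0) (x 1) (x 2) (x 3)), quat (x 4) 0 0 0]

theorem fin_two_conjTranspose (a b c d : ℍ[ℝ]) :
    (!![a, b; c, d])ᴴ = !![star a, star c; star b, star d] := by
  refine Matrix.ext fun i j => ?_
  fin_cases i <;> fin_cases j <;> rfl

/-- The matrix of `η(A)`, for `A` with rows `(a, b)` and `(c, d)` and each quaternion written as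
`q₀ + q₁ i + q₂ j + q₃ k`. For `A` in `SU(1,1;ℍ)` and `x` in `ℝ⁵` one has
`herm (η(A)x) = A (herm x) A*`, so that `η(diag(p,q))` acts on `ℝ⁴ = ℍ` by `v ↦ p v q̄`. -/
def etaMat (A : Matrix (Fin 2) (Fin 2) ℍ[ℝ]) : Matrix (Fin 5) (Fin 5) ℝ :=
  let a₀ := (A 0 0).re; let a₁ := (A 0 0).imI; let a₂ := (A 0 0).imJ; let a₃ := (A 0 0).imK
  let b₀ := (A 0 1).re; let b₁ := (A 0 1).imI; let b₂ := (A 0 1).imJ; let b₃ := (A 0 1).imK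
  let c₀ := (A 1 0).re; let c₁ := (A 1 0).imI; let c₂ := (A 1 0).imJ; let c₃ := (A 1 0).imK
  let d₀ := (A 1 1).re; let d₁ := (A 1 1).imI; let d₂ := (A 1 1).imJ; let d₃ := (A 1 1).imK
  !![
    b₀ * c₀ + b₁ * c₁ + b₂ * c₂ + b₃ * c₃ + a₀ * d₀ + a₁ * d₁ + a₂ * d₂ + a₃ * d₃,
    b₁ * c₀ - b₀ * c₁ - b₃ * c₂ + b₂ * c₃ - a₁ * d₀ + a₀ * d₁ + a₃ * d₂ - a₂ * d₃,
    b₂ * c₀ + b₃ * c₁ - b₀ * c₂ - b₁ * c₃ - a₂ * d₀ - a₃ * d₁ + a₀ * d₂ + a₁ * d₃,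
    b₃ * c₀ - b₂ * c₁ + b₁ * c₂ - b₀ * c₃ - a₃ * d₀ + a₂ * d₁ - a₁ * d₂ + a₀ * d₃,
    2 * b₀ * d₀ + 2 * b₁ * d₁ + 2 * b₂ * d₂ + 2 * b₃ * d₃;
    b₁ * c₀ - b₀ * c₁ + b₃ * c₂ - b₂ * c₃ + a₁ * d₀ - a₀ * d₁ + a₃ * d₂ - a₂ * d₃,
    -b₀ * c₀ - b₁ * c₁ + b₂ * c₂ + b₃ * c₃ + a₀ * d₀ + a₁ * d₁ - a₂ * d₂ - a₃ * d₃,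
    b₃ * c₀ - b₂ * c₁ - b₁ * c₂ + b₀ * c₃ - a₃ * d₀ + a₂ * d₁ + a₁ * d₂ - a₀ * d₃,
    -b₂ * c₀ - b₃ * c₁ - b₀ * c₂ - b₁ * c₃ + a₂ * d₀ + a₃ * d₁ + a₀ * d₂ + a₁ * d₃,
    2 * b₁ * d₀ - 2 * b₀ * d₁ + 2 * b₃ * d₂ - 2 * b₂ * d₃;
    b₂ * c₀ - b₃ * c₁ - b₀ * c₂ + b₁ * c₃ + a₂ * d₀ - a₃ * d₁ - a₀ * d₂ + a₁ * d₃,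
    -b₃ * c₀ - b₂ * c₁ - b₁ * c₂ - b₀ * c₃ + a₃ * d₀ + a₂ * d₁ + a₁ * d₂ + a₀ * d₃,
    -b₀ * c₀ + b₁ * c₁ - b₂ * c₂ + b₃ * c₃ + a₀ * d₀ - a₁ * d₁ + a₂ * d₂ - a₃ * d₃,
    b₁ * c₀ + b₀ * c₁ - b₃ * c₂ - b₂ * c₃ - a₁ * d₀ - a₀ * d₁ + a₃ * d₂ + a₂ * d₃,
    2 * b₂ * d₀ - 2 * b₃ * d₁ - 2 * b₀ * d₂ + 2 * b₁ * d₃;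
    b₃ * c₀ + b₂ * c₁ - b₁ * c₂ - b₀ * c₃ + a₃ * d₀ + a₂ * d₁ - a₁ * d₂ - a₀ * d₃,
    b₂ * c₀ - b₃ * c₁ + b₀ * c₂ - b₁ * c₃ - a₂ * d₀ + a₃ * d₁ - a₀ * d₂ + a₁ * d₃,
    -b₁ * c₀ - b₀ * c₁ - b₃ * c₂ - b₂ * c₃ + a₁ * d₀ + a₀ * d₁ + a₃ * d₂ + a₂ * d₃,
    -b₀ * c₀ + b₁ * c₁ + b₂ * c₂ - b₃ * c₃ + a₀ * d₀ - a₁ * d₁ - a₂ * d₂ + a₃ * d₃,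
    2 * b₃ * d₀ + 2 * b₂ * d₁ - 2 * b₁ * d₂ - 2 * b₀ * d₃;
    2 * a₀ * b₀ + 2 * a₁ * b₁ + 2 * a₂ * b₂ + 2 * a₃ * b₃,
    -2 * a₁ * b₀ + 2 * a₀ * b₁ + 2 * a₃ * b₂ - 2 * a₂ * b₃,
    -2 * a₂ * b₀ - 2 * a₃ * b₁ + 2 * a₀ * b₂ + 2 * a₁ * b₃,
    -2 * a₃ * b₀ + 2 * a₂ * b₁ - 2 * a₁ * b₂ + 2 * a₀ * b₃,
    a₀ ^ 2 + a₁ ^ 2 + a₂ ^ 2 + a₃ ^ 2 + b₀ ^ 2 + b₁ ^ 2 + b₂ ^ 2 + b₃ ^ 2]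

theorem su_rel {a b c d : ℍ[ℝ]} (h1 : (!![a, b; c, d])ᴴ * Jmat * !![a, b; c, d] = Jmat)
    (h2 : !![a, b; c, d] * Jmat * (!![a, b; c, d])ᴴ = Jmat) :
    star a * a - star c * c = 1 ∧ star a * b = star c * d ∧ star b * b - star d * d = -1 ∧
    a * star a - b * star b = 1 ∧ a * star c = b * star d ∧ c * star c - d * star d = -1 := by
  rw [fin_two_conjTranspose, Jmat, Matrix.mul_fin_two, Matrix.mul_fin_two] at h1 h2
  have k00 := congrFun (congrFun h1 0) 0
  have k01 := congrFun (congrFun h1 0) 1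
  have k11 := congrFun (congrFun h1 1) 1
  have l00 := congrFun (congrFun h2 0) 0
  have l01 := congrFun (congrFun h2 0) 1
  have l11 := congrFun (congrFun h2 1) 1
  simp [← sub_eq_add_neg, sub_eq_zero] at k00 k01 k11 l00 l01 l11
  exact ⟨k00, k01, k11, l00, l01, l11⟩

theorem herm_eta (A : SU11) (x : Fin 5 → ℝ) :
    mat A * herm x * (mat A)ᴴ = herm (etaMat (mat A) *ᵥ x) := by
  have h1 := star_mat_mul A
  have h2 := mat_mul_star A
  generalize mat A = M at *
  obtain ⟨a, b, c, d, rfl⟩ : ∃ a b c d, M = !![a, b; c, d] :=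
    ⟨_, _, _, _, Matrix.eta_fin_two M⟩
  obtain ⟨k1, k2, k3, l1, l2, l3⟩ := su_rel h1 h2
  clear h1 h2
  rw [fin_two_conjTranspose, herm, herm, Matrix.mul_fin_two, Matrix.mul_fin_two]
  have hx : ∀ a : ℍ[ℝ], ∃ r s t u, a = quat r s t u := fun a => ⟨a.re, a.imI, a.imJ, a.imK, rfl⟩
  obtain ⟨a₀, a₁, a₂, a₃, rfl⟩ := hx a
  obtain ⟨b₀, b₁, b₂, b₃, rfl⟩ := hx b
  obtain ⟨c₀, c₁, c₂, c₃, rfl⟩ := hx c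
  obtain ⟨d₀, d₁, d₂, d₃, rfl⟩ := hx d
  simp only [Quaternion.ext_iff, Quaternion.re_sub, Quaternion.imI_sub, Quaternion.imJ_sub,
    Quaternion.imK_sub, Quaternion.re_mul, Quaternion.imI_mul,
    Quaternion.imJ_mul, Quaternion.imK_mul, Quaternion.re_star, Quaternion.imI_star,
    Quaternion.imJ_star, Quaternion.imK_star, Quaternion.re_one, Quaternion.re_neg,
    quat_re, quat_imI, quat_imJ, quat_imK] at k1 k2 k3 l1 l2 l3
  obtain ⟨k10, -⟩ := k1
  obtain ⟨k20, k21, k22, k23⟩ := k2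
  obtain ⟨k30, -⟩ := k3
  obtain ⟨l10, -⟩ := l1
  obtain ⟨l20, l21, l22, l23⟩ := l2
  obtain ⟨l30, -⟩ := l3
  refine Matrix.ext fun i j => Quaternion.ext_iff.mpr ⟨?_, ?_, ?_, ?_⟩
  all_goals fin_cases i <;> fin_cases j
  all_goals
    simp only [Matrix.of_apply, Matrix.cons_val, Fin.zero_eta, Fin.mk_one, Quaternion.re_add,
      Quaternion.imI_add, Quaternion.imJ_add, Quaternion.imK_add,
      Quaternion.re_mul, Quaternion.imI_mul,
      Quaternion.imJ_mul, Quaternion.imK_mul, Quaternion.re_star, Quaternion.imI_star,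
      Quaternion.imJ_star, Quaternion.imK_star, quat_re, quat_imI, quat_imJ, quat_imK,
      etaMat, Matrix.mulVec, dotProduct, Fin.sum_univ_five]
  · ring
  · linear_combination x 4 * l20
  · linear_combination x 4 * l20
  · linear_combination -2 * (x 0 * k20 + x 1 * k21 + x 2 * k22 + x 3 * k23) - x 4 * (k10 + k30)
  · ring
  · linear_combination x 4 * l21
  · linear_combination -x 4 * l21
  · ring
  · ring
  · linear_combination x 4 * l22
  · linear_combination -x 4 * l22
  · ring
  · ring
  · linear_combination x 4 * l23
  · linear_combination -x 4 * l23
  · ring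

/-- The Lorentzian inner product of signature `(4,1)` on `ℝ⁵`. -/
def lor (x y : Fin 5 → ℝ) : ℝ := x 0 * y 0 + x 1 * y 1 + x 2 * y 2 + x 3 * y 3 - x 4 * y 4

/-- Hyperbolic 4-space in the hyperboloid model, with the subspace topology. -/
abbrev H4 : Type := {x : Fin 5 → ℝ // lor x x = -1 ∧ 0 < x 4}

theorem neg_mem_H4 {x : Fin 5 → ℝ} (h : lor x x = -1) (hx : ¬ 0 < x 4) :
    lor (-x) (-x) = -1 ∧ 0 < (-x) 4 := by
  have h4 : x 4 ≠ 0 := by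
    intro h4
    simp only [lor, h4] at h
    nlinarith [sq_nonneg (x 0), sq_nonneg (x 1), sq_nonneg (x 2), sq_nonneg (x 3)]
  refine ⟨by simpa [lor] using h, ?_⟩
  simp only [Pi.neg_apply]
  have := lt_of_le_of_ne (not_lt.mp hx) h4
  linarith

/-- `SO⁺(4,1)`: the real matrices of determinant one that preserve the Lorentzian inner product and
map the hyperboloid sheet `H⁴` into itself. -/
def SOplus : Subgroup (Matrix.SpecialLinearGroup (Fin 5) ℝ) where
  carrier := {A | (∀ x y, lor (A.1 *ᵥ x) (A.1 *ᵥ y) = lor x y) ∧ ∀ x : H4, 0 < (A.1 *ᵥ x.1) 4}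
  mul_mem' := by
    rintro A B ⟨hA, hA'⟩ ⟨hB, hB'⟩
    refine ⟨fun x y => ?_, fun x => ?_⟩
    · simp only [Matrix.SpecialLinearGroup.coe_mul, ← Matrix.mulVec_mulVec, hA, hB]
    · have := hA' ⟨B.1 *ᵥ x.1, by rw [hB]; exact x.2.1, hB' x⟩
      simpa only [Matrix.SpecialLinearGroup.coe_mul, ← Matrix.mulVec_mulVec] using this
  one_mem' := by
    refine ⟨fun x y => by simp, fun x => by simpa using x.2.2⟩
  inv_mem' := by
    rintro A ⟨hA, hA'⟩
    have e : ∀ x, A.1 *ᵥ ((A⁻¹).1 *ᵥ x) = x := fun x => by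
      rw [Matrix.mulVec_mulVec, ← Matrix.SpecialLinearGroup.coe_mul, mul_inv_cancel]; simp
    have hi : ∀ x y, lor ((A⁻¹).1 *ᵥ x) ((A⁻¹).1 *ᵥ y) = lor x y := fun x y => by
      rw [← hA, e, e]
    refine ⟨hi, fun x => ?_⟩
    by_contra hx
    have h1 := neg_mem_H4 (by rw [hi]; exact x.2.1) hx
    have h2 := hA' ⟨_, h1⟩
    simp only [Matrix.mulVec_neg, e, Pi.neg_apply] at h2
    linarith [x.2.2]

/-- The matrix underlying an element of `SO⁺(4,1)`. -/
abbrev rmat (A : SOplus) : Matrix (Fin 5) (Fin 5) ℝ :=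
  ((A : Matrix.SpecialLinearGroup (Fin 5) ℝ) : Matrix (Fin 5) (Fin 5) ℝ)

/-- `SO⁺(4,1)` acts on `H⁴` by matrix multiplication. -/
instance : MulAction SOplus H4 where
  smul A x := ⟨rmat A *ᵥ x.1, by rw [A.2.1]; exact x.2.1, A.2.2 x⟩
  one_smul x := Subtype.ext (by
    change (1 : Matrix (Fin 5) (Fin 5) ℝ) *ᵥ x.1 = x.1
    simp)
  mul_smul A B x := Subtype.ext (by
    change (A.1.1 * B.1.1) *ᵥ x.1 = A.1.1 *ᵥ (B.1.1 *ᵥ x.1)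
    simp)

theorem herm_injective : Function.Injective herm := by
  intro x y h
  have h0 := congrFun (congrFun h 0) 0
  have h1 := congrFun (congrFun h 0) 1
  simp only [herm, Matrix.of_apply, Matrix.cons_val, Quaternion.ext_iff, quat_re, quat_imI,
    quat_imJ, quat_imK] at h0 h1
  funext i
  fin_cases i
  exacts [h1.1, h1.2.1, h1.2.2.1, h1.2.2.2, h0.1]

theorem etaMat_mul (A B : SU11) : etaMat (mat (A * B)) = etaMat (mat A) * etaMat (mat B) := by
  have : ∀ x, etaMat (mat (A * B)) *ᵥ x = (etaMat (mat A) * etaMat (mat B)) *ᵥ x := fun x => by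
    apply herm_injective
    rw [← herm_eta, ← Matrix.mulVec_mulVec, ← herm_eta, ← herm_eta]
    change (mat A * mat B) * _ * (mat A * mat B)ᴴ = _
    rw [Matrix.conjTranspose_mul]
    simp only [mul_assoc]
  exact Matrix.ext_of_mulVec_single fun i => this _

theorem herm_sq (x : Fin 5 → ℝ) :
    herm x * Jmat * herm x * Jmat = (-lor x x) • (1 : Matrix (Fin 2) (Fin 2) ℍ[ℝ]) := by
  rw [herm, Jmat, Matrix.mul_fin_two, Matrix.mul_fin_two, Matrix.mul_fin_two, Matrix.one_fin_two,
    Matrix.smul_of]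
  refine Matrix.ext fun i j => Quaternion.ext_iff.mpr ⟨?_, ?_, ?_, ?_⟩
  all_goals fin_cases i <;> fin_cases j
  all_goals
    simp [lor]
  all_goals ring

theorem lor_eta_self (A : SU11) (x : Fin 5 → ℝ) :
    lor (etaMat (mat A) *ᵥ x) (etaMat (mat A) *ᵥ x) = lor x x := by
  have h : herm (etaMat (mat A) *ᵥ x) * Jmat * herm (etaMat (mat A) *ᵥ x) * Jmat =
      (-lor x x) • (1 : Matrix (Fin 2) (Fin 2) ℍ[ℝ]) := by
    rw [← herm_eta]
    have e1 : herm x * Jmat * herm x = (-lor x x) • Jmat := by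
      calc herm x * Jmat * herm x = herm x * Jmat * herm x * Jmat * Jmat := by
            rw [mul_assoc _ Jmat Jmat, Jmat_sq, mul_one]
        _ = _ := by rw [herm_sq, smul_mul_assoc, one_mul]
    calc mat A * herm x * (mat A)ᴴ * Jmat * (mat A * herm x * (mat A)ᴴ) * Jmat
        = mat A * (herm x * ((mat A)ᴴ * Jmat * mat A) * herm x) * (mat A)ᴴ * Jmat := by
          simp only [mul_assoc]
      _ = (-lor x x) • ((mat A * Jmat * (mat A)ᴴ) * Jmat) := by
          rw [star_mat_mul, e1]; simp only [mul_smul_comm, smul_mul_assoc]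
      _ = _ := by rw [mat_mul_star, Jmat_sq]
  rw [herm_sq] at h
  have h0 := congrArg QuaternionAlgebra.re (congrFun (congrFun h 0) 0)
  simpa using h0

theorem lor_eta (A : SU11) (x y : Fin 5 → ℝ) :
    lor (etaMat (mat A) *ᵥ x) (etaMat (mat A) *ᵥ y) = lor x y := by
  have h1 := lor_eta_self A (x + y)
  have h2 := lor_eta_self A x
  have h3 := lor_eta_self A y
  rw [Matrix.mulVec_add] at h1
  simp only [lor, Pi.add_apply] at h1 h2 h3 ⊢
  linarith

theorem pos_aux (w0 w1 w2 w3 x0 x1 x2 x3 x4 N : ℝ) (hN : 0 < N) (hx4 : 0 < x4)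
    (hw : w0 ^ 2 + w1 ^ 2 + w2 ^ 2 + w3 ^ 2 ≤ N ^ 2)
    (hv : x0 ^ 2 + x1 ^ 2 + x2 ^ 2 + x3 ^ 2 = x4 ^ 2 - 1) :
    0 < w0 * x0 + w1 * x1 + w2 * x2 + w3 * x3 + N * x4 := by
  have hcs : (w0 ^ 2 + w1 ^ 2 + w2 ^ 2 + w3 ^ 2) * (x0 ^ 2 + x1 ^ 2 + x2 ^ 2 + x3 ^ 2) -
      (w0 * x0 + w1 * x1 + w2 * x2 + w3 * x3) ^ 2 =
      (w0 * x1 - w1 * x0) ^ 2 + (w0 * x2 - w2 * x0) ^ 2 + (w0 * x3 - w3 * x0) ^ 2 +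
      (w1 * x2 - w2 * x1) ^ 2 + (w1 * x3 - w3 * x1) ^ 2 + (w2 * x3 - w3 * x2) ^ 2 := by ring
  have hcs0 : 0 ≤ (w0 * x1 - w1 * x0) ^ 2 + (w0 * x2 - w2 * x0) ^ 2 + (w0 * x3 - w3 * x0) ^ 2 +
      (w1 * x2 - w2 * x1) ^ 2 + (w1 * x3 - w3 * x1) ^ 2 + (w2 * x3 - w3 * x2) ^ 2 := by positivity
  have hnn : 0 ≤ x0 ^ 2 + x1 ^ 2 + x2 ^ 2 + x3 ^ 2 := by positivity
  have h5 := mul_le_mul_of_nonneg_right hw hnn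
  have h6 : 0 < N ^ 2 := by positivity
  rw [hv] at h5 hcs
  have hlt : (w0 * x0 + w1 * x1 + w2 * x2 + w3 * x3) ^ 2 < (N * x4) ^ 2 := by
    rw [mul_pow]; linarith
  have := (abs_lt_of_sq_lt_sq' hlt (by positivity)).1
  linarith

theorem eta_pos (A : SU11) (x : H4) : 0 < (etaMat (mat A) *ᵥ x.1) 4 := by
  have h1 := star_mat_mul A
  have h2 := mat_mul_star A
  generalize mat A = M at *
  obtain ⟨a, b, c, d, rfl⟩ : ∃ a b c d, M = !![a, b; c, d] :=
    ⟨_, _, _, _, Matrix.eta_fin_two M⟩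
  obtain ⟨-, -, -, l1, -, -⟩ := su_rel h1 h2
  clear h1 h2
  have hx : ∀ a : ℍ[ℝ], ∃ r s t u, a = quat r s t u := fun a => ⟨a.re, a.imI, a.imJ, a.imK, rfl⟩
  obtain ⟨a₀, a₁, a₂, a₃, rfl⟩ := hx a
  obtain ⟨b₀, b₁, b₂, b₃, rfl⟩ := hx b
  obtain ⟨x, hx1, hx4⟩ := x
  have l10 := congrArg QuaternionAlgebra.re l1
  simp only [Quaternion.re_sub, Quaternion.re_mul, Quaternion.re_star, Quaternion.imI_star,
    Quaternion.imJ_star, Quaternion.imK_star, Quaternion.re_one,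
    quat_re, quat_imI, quat_imJ, quat_imK] at l10
  simp only [Matrix.of_apply, Matrix.cons_val, quat_re, quat_imI, quat_imJ, quat_imK,
      etaMat, Matrix.mulVec, dotProduct, Fin.sum_univ_five]
  simp only [lor] at hx1
  set N := a₀ ^ 2 + a₁ ^ 2 + a₂ ^ 2 + a₃ ^ 2 + b₀ ^ 2 + b₁ ^ 2 + b₂ ^ 2 + b₃ ^ 2 with hN
  have hNpos : 0 < N := by
    nlinarith [sq_nonneg b₀, sq_nonneg b₁, sq_nonneg b₂, sq_nonneg b₃]
  set w0 := 2 * a₀ * b₀ + 2 * a₁ * b₁ + 2 * a₂ * b₂ + 2 * a₃ * b₃ with h0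
  set w1 := -2 * a₁ * b₀ + 2 * a₀ * b₁ + 2 * a₃ * b₂ - 2 * a₂ * b₃ with h1
  set w2 := -2 * a₂ * b₀ - 2 * a₃ * b₁ + 2 * a₀ * b₂ + 2 * a₁ * b₃ with h2
  set w3 := -2 * a₃ * b₀ + 2 * a₂ * b₁ - 2 * a₁ * b₂ + 2 * a₀ * b₃ with h3
  have hw : w0 ^ 2 + w1 ^ 2 + w2 ^ 2 + w3 ^ 2 ≤ N ^ 2 := by
    have : N ^ 2 - (w0 ^ 2 + w1 ^ 2 + w2 ^ 2 + w3 ^ 2) =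
        (a₀ ^ 2 + a₁ ^ 2 + a₂ ^ 2 + a₃ ^ 2 - (b₀ ^ 2 + b₁ ^ 2 + b₂ ^ 2 + b₃ ^ 2)) ^ 2 := by
      rw [hN, h0, h1, h2, h3]; ring
    nlinarith [sq_nonneg (a₀ ^ 2 + a₁ ^ 2 + a₂ ^ 2 + a₃ ^ 2 - (b₀ ^ 2 + b₁ ^ 2 + b₂ ^ 2 + b₃ ^ 2))]
  clear_value w0 w1 w2 w3 N
  have := pos_aux w0 w1 w2 w3 (x 0) (x 1) (x 2) (x 3) (x 4) N hNpos hx4 hw (by linarith)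
  linarith

/-- An element of `SU(1,1;ℍ)` from a matrix satisfying both relations. -/
def mkSU (M : Matrix (Fin 2) (Fin 2) ℍ[ℝ]) (h1 : Mᴴ * Jmat * M = Jmat)
    (h2 : M * Jmat * Mᴴ = Jmat) : SU11 :=
  ⟨⟨M, Jmat * Mᴴ * Jmat,
    by rw [← mul_assoc, ← mul_assoc, h2, Jmat_sq],
    by rw [mul_assoc, mul_assoc, ← mul_assoc _ Jmat, h1, Jmat_sq]⟩, h1⟩

theorem det_boost (α : ℝ) (β : ℍ[ℝ]) (h : α ^ 2 - Quaternion.normSq β = 1) :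
    (etaMat !![quat α 0 0 0, β; star β, quat α 0 0 0]).det = 1 := by
  obtain ⟨b₀, b₁, b₂, b₃, rfl⟩ : ∃ r s t u, β = quat r s t u :=
    ⟨β.re, β.imI, β.imJ, β.imK, rfl⟩
  have : (etaMat !![quat α 0 0 0, quat b₀ b₁ b₂ b₃; star (quat b₀ b₁ b₂ b₃), quat α 0 0 0]).det =
      (α ^ 2 - Quaternion.normSq (quat b₀ b₁ b₂ b₃)) ^ 5 := by
    simp [etaMat, Matrix.det_succ_row_zero, Fin.sum_univ_succ, Fin.succAbove, Quaternion.normSq_def']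
    ring
  rw [this, h, one_pow]

theorem det_left (p : ℍ[ℝ]) (h : Quaternion.normSq p = 1) :
    (etaMat !![p, 0; 0, 1]).det = 1 := by
  obtain ⟨b₀, b₁, b₂, b₃, rfl⟩ : ∃ r s t u, p = quat r s t u :=
    ⟨p.re, p.imI, p.imJ, p.imK, rfl⟩
  have : (etaMat !![quat b₀ b₁ b₂ b₃, 0; 0, 1]).det =
      (Quaternion.normSq (quat b₀ b₁ b₂ b₃)) ^ 3 := by
    simp [etaMat, Matrix.det_succ_row_zero, Fin.sum_univ_succ, Fin.succAbove, Quaternion.normSq_def']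
    ring
  rw [this, h, one_pow]

theorem det_right (p : ℍ[ℝ]) (h : Quaternion.normSq p = 1) :
    (etaMat !![1, 0; 0, p]).det = 1 := by
  obtain ⟨b₀, b₁, b₂, b₃, rfl⟩ : ∃ r s t u, p = quat r s t u :=
    ⟨p.re, p.imI, p.imJ, p.imK, rfl⟩
  have : (etaMat !![1, 0; 0, quat b₀ b₁ b₂ b₃]).det =
      (Quaternion.normSq (quat b₀ b₁ b₂ b₃)) ^ 2 := by
    simp [etaMat, Matrix.det_succ_row_zero, Fin.sum_univ_succ, Fin.succAbove, Quaternion.normSq_def']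
    ring
  rw [this, h, one_pow]

theorem eta_det (A : SU11) : (etaMat (mat A)).det = 1 := by
  obtain ⟨a, b, c, d, hM⟩ : ∃ a b c d, mat A = !![a, b; c, d] :=
    ⟨_, _, _, _, Matrix.eta_fin_two (mat A)⟩
  have h1 := star_mat_mul A
  have h2 := mat_mul_star A
  rw [hM] at h1 h2
  obtain ⟨k1, k2, k3, l1, l2, l3⟩ := su_rel h1 h2
  clear h1 h2
  have hn : ∀ q : ℍ[ℝ], star q * q = ((Quaternion.normSq q : ℝ) : ℍ[ℝ]) := fun q => Quaternion.star_mul_self q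
  have hn' : ∀ q : ℍ[ℝ], q * star q = ((Quaternion.normSq q : ℝ) : ℍ[ℝ]) := fun q => Quaternion.self_mul_star q
  have m1 : Quaternion.normSq a - Quaternion.normSq c = 1 := by
    rw [hn, hn] at k1; simpa using congrArg QuaternionAlgebra.re k1
  have m3 : Quaternion.normSq b - Quaternion.normSq d = -1 := by
    rw [hn, hn] at k3; simpa using congrArg QuaternionAlgebra.re k3
  have m2 : Quaternion.normSq c - Quaternion.normSq d = -1 := by
    rw [hn', hn'] at l3; simpa using congrArg QuaternionAlgebra.re l3
  obtain ⟨α, hα, hαd⟩ : ∃ α : ℝ, 0 < α ∧ α ^ 2 = Quaternion.normSq d := by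
    have : 0 < Quaternion.normSq d := by
      have := Quaternion.normSq_nonneg (a := c)
      linarith
    exact ⟨√(Quaternion.normSq d), Real.sqrt_pos.mpr this, Real.sq_sqrt this.le⟩
  have hαa : α ^ 2 = Quaternion.normSq a := by linarith
  have hα0 : α ≠ 0 := hα.ne'
  set p : ℍ[ℝ] := (α⁻¹ : ℝ) • a with hp
  set q : ℍ[ℝ] := (α⁻¹ : ℝ) • d with hq
  have np : Quaternion.normSq p = 1 := by
    rw [hp, Quaternion.normSq_smul, ← hαa]; field_simp
  have nq : Quaternion.normSq q = 1 := by
    rw [hq, Quaternion.normSq_smul, ← hαd]; field_simp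
  set β : ℍ[ℝ] := b * star q with hβ
  have nβ : Quaternion.normSq β = Quaternion.normSq b := by
    rw [hβ, map_mul, Quaternion.normSq_star, nq, mul_one]
  have hT : α ^ 2 - Quaternion.normSq β = 1 := by rw [nβ]; linarith
  have hqr : quat α 0 0 0 = (α : ℍ[ℝ]) := rfl
  have sq : star (α : ℍ[ℝ]) = (α : ℍ[ℝ]) := Quaternion.star_coe α
  have e1 : (α : ℍ[ℝ]) * α - β * star β = 1 := by
    have : α * α - Quaternion.normSq β = 1 := by rw [← hT]; ring
    rw [hn']; simpa using congrArg (fun r : ℝ => (r : ℍ[ℝ])) this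
  have e2 : star β * β - (α : ℍ[ℝ]) * α = -1 := by
    rw [hn, ← hn', ← neg_sub, e1]
  have e2' : β * star β - (α : ℍ[ℝ]) * α = -1 := by
    rw [← neg_sub, e1]
  have e1' : (α : ℍ[ℝ]) * α - star β * β = 1 := by
    rw [← neg_sub, e2, neg_neg]
  have ec : (α : ℍ[ℝ]) * β = β * α := Quaternion.coe_commutes α β
  have ec' : (α : ℍ[ℝ]) * star β = star β * α := Quaternion.coe_commutes α (star β)
  let T : SU11 := mkSU !![quat α 0 0 0, β; star β, quat α 0 0 0]
    (by
      rw [hqr, fin_two_conjTranspose, Jmat, Matrix.mul_fin_two, Matrix.mul_fin_two]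
      simp [sq, ← sub_eq_add_neg, e1, e2, ec, ec'])
    (by
      rw [hqr, fin_two_conjTranspose, Jmat, Matrix.mul_fin_two, Matrix.mul_fin_two]
      simp [sq, ← sub_eq_add_neg, e1, e2, ec, ec'])
  let P : SU11 := mkSU !![p, 0; 0, 1]
    (by
      rw [fin_two_conjTranspose, Jmat, Matrix.mul_fin_two, Matrix.mul_fin_two]
      simp [hn, np])
    (by
      rw [fin_two_conjTranspose, Jmat, Matrix.mul_fin_two, Matrix.mul_fin_two]
      simp [hn', np])
  let Q : SU11 := mkSU !![1, 0; 0, q]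
    (by
      rw [fin_two_conjTranspose, Jmat, Matrix.mul_fin_two, Matrix.mul_fin_two]
      simp [hn, nq])
    (by
      rw [fin_two_conjTranspose, Jmat, Matrix.mul_fin_two, Matrix.mul_fin_two]
      simp [hn', nq])
  have hA : A = T * P * Q := by
    refine Subtype.ext (Units.ext ?_)
    change mat A = !![quat α 0 0 0, β; star β, quat α 0 0 0] * !![p, 0; 0, 1] * !![1, 0; 0, q]
    rw [hM, hqr, Matrix.mul_fin_two, Matrix.mul_fin_two]
    have r1 : (α : ℍ[ℝ]) * p = a := by
      rw [hp, Quaternion.coe_mul_eq_smul, smul_smul, mul_inv_cancel₀ hα0, one_smul]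
    have r2 : (α : ℍ[ℝ]) * q = d := by
      rw [hq, Quaternion.coe_mul_eq_smul, smul_smul, mul_inv_cancel₀ hα0, one_smul]
    have r3 : β * q = b := by
      rw [hβ, mul_assoc, hn, nq]; simp
    have r4 : star β * p = c := by
      have k2' : star b * a = star d * c := by
        have := congrArg star k2
        simpa using this
      rw [hβ, StarMul.star_mul, star_star, hp, mul_smul_comm, mul_assoc, k2', ← mul_assoc, hq,
        smul_mul_assoc, hn', ← hαd, smul_mul_assoc, smul_smul, Quaternion.coe_mul_eq_smul,
        smul_smul]
      rw [show α⁻¹ * α⁻¹ * α ^ 2 = 1 by field_simp, one_smul]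
    simp [r1, r2, r3, r4]
  rw [hA, etaMat_mul, etaMat_mul, Matrix.det_mul, Matrix.det_mul]
  change (etaMat !![quat α 0 0 0, β; star β, quat α 0 0 0]).det * (etaMat !![p, 0; 0, 1]).det *
    (etaMat !![1, 0; 0, q]).det = 1
  rw [det_boost α β hT, det_left p np, det_right q nq]; norm_num

/-- The double covering `η : SU(1,1;ℍ) → SO⁺(4,1)`. -/
def eta : SU11 →* SOplus where
  toFun A := ⟨⟨etaMat (mat A), eta_det A⟩, lor_eta A, eta_pos A⟩
  map_one' := by
    refine Subtype.ext (Subtype.ext ?_)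
    change etaMat (1 : Matrix (Fin 2) (Fin 2) ℍ[ℝ]) = 1
    ext i j
    fin_cases i <;> fin_cases j <;> simp [etaMat]
  map_mul' A B := Subtype.ext (Subtype.ext (etaMat_mul A B))

/-! ### Spin structures on closed hyperbolic 4-manifolds -/

/-- The point `e₅` of `H⁴`. -/
def basePt : H4 := ⟨![0, 0, 0, 0, 1], by simp [lor]⟩

/-- `Spin(4) = η⁻¹(SO(4))`, where `SO(4)` is the stabilizer of `e₅` in `SO⁺(4,1)`. -/
def Spin4 : Subgroup SU11 := (MulAction.stabilizer SOplus basePt).comap eta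

/-- A closed hyperbolic 4-manifold `M = Γ\H⁴`, where `Γ` is a discrete, freely acting, cocompact
subgroup of `SO⁺(4,1)`, together with a spin structure `Γ̂\SU(1,1;ℍ)` on `M`, where `Γ̂` is a
subgroup of `SU(1,1;ℍ)` that `η` maps bijectively onto `Γ`. -/
structure SpinClosedHyperbolic4 where
  Γ : Subgroup SOplus
  Γh : Subgroup SU11
  discrete : DiscreteTopology Γ
  free : ∀ γ ∈ Γ, ∀ x : H4, γ • x = x → γ = 1
  compact : CompactSpace (Quotient (MulAction.orbitRel Γ H4))
  lift : Set.BijOn eta (Γh : Set SU11) (Γ : Set SOplus)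

namespace SpinClosedHyperbolic4

variable (X : SpinClosedHyperbolic4)

/-- The manifold `M = Γ\H⁴`, with the quotient topology. -/
abbrev M : Type := Quotient (MulAction.orbitRel X.Γ H4)

/-- The point `Γx` of `M`. -/
def pt (x : H4) : X.M := Quotient.mk _ x

/-- The total space `Γ̂\SU(1,1;ℍ)` of the spin structure. -/
abbrev SpinBundle : Type := Quotient (MulAction.orbitRel X.Γh SU11)

/-- The point `Γ̂g` of the spin structure. -/
def spinPt (g : SU11) : X.SpinBundle := Quotient.mk _ g

theorem pt_eq_iff {x y : H4} : X.pt x = X.pt y ↔ ∃ γ ∈ X.Γ, γ • y = x := by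
  rw [pt, pt, Quotient.eq, MulAction.orbitRel_apply, MulAction.mem_orbit_iff]
  exact ⟨fun ⟨γ, h⟩ => ⟨γ, γ.2, h⟩, fun ⟨γ, hγ, h⟩ => ⟨⟨γ, hγ⟩, h⟩⟩

theorem spinPt_eq_iff {g h : SU11} : X.spinPt g = X.spinPt h ↔ ∃ γ ∈ X.Γh, γ * h = g := by
  rw [spinPt, spinPt, Quotient.eq, MulAction.orbitRel_apply, MulAction.mem_orbit_iff]
  exact ⟨fun ⟨γ, h⟩ => ⟨γ, γ.2, h⟩, fun ⟨γ, hγ, h⟩ => ⟨⟨γ, hγ⟩, h⟩⟩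

/-- The bundle projection `Γ̂g ↦ Γ(η(g)e₅)`. -/
def proj : X.SpinBundle → X.M :=
  Quotient.lift (fun g => X.pt (eta g • basePt)) (by
    intro g h hgh
    obtain ⟨γ, hγ, rfl⟩ := X.spinPt_eq_iff.mp (Quotient.sound hgh)
    exact X.pt_eq_iff.mpr ⟨eta γ, X.lift.mapsTo hγ, by rw [map_mul, mul_smul]⟩)

/-- The principal right action of `Spin(4)` on the spin structure, `(Γ̂g)s = Γ̂(gs)`. -/
def rmul (s : Spin4) : X.SpinBundle → X.SpinBundle :=
  Quotient.lift (fun g => X.spinPt (g * s)) (by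
    intro g h hgh
    obtain ⟨γ, hγ, rfl⟩ := X.spinPt_eq_iff.mp (Quotient.sound hgh)
    exact X.spinPt_eq_iff.mpr ⟨γ, hγ, by rw [mul_assoc]⟩)

/-- A symmetry `φ̂ = f̂_⋆` of the spin structure, given by `Γ̂g ↦ Γ̂f̂g` for some `f̂` in the
normalizer of `Γ̂`, together with the orientation-preserving isometry `φ = f_⋆ : Γx ↦ Γfx` of `M`,
`f = η(f̂)`, of which it is a lift. -/
structure SpinSymmetry where
  bundleMap : X.SpinBundle ≃ X.SpinBundle
  base : X.M → X.M
  exists_rep : ∃ f ∈ Subgroup.normalizer (X.Γh : Set SU11),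
    (∀ g, bundleMap (X.spinPt g) = X.spinPt (f * g)) ∧ ∀ x, base (X.pt x) = X.pt (eta f • x)

variable {X}

theorem eta_mem_normalizer {f : SU11} (hf : f ∈ Subgroup.normalizer (X.Γh : Set SU11)) :
    eta f ∈ Subgroup.normalizer (X.Γ : Set SOplus) := by
  have key : ∀ f ∈ Subgroup.normalizer (X.Γh : Set SU11), ∀ γ ∈ X.Γ,
      eta f * γ * (eta f)⁻¹ ∈ X.Γ := by
    intro f hf γ hγ
    obtain ⟨γ', hγ', rfl⟩ := X.lift.surjOn hγ
    rw [← map_inv, ← map_mul, ← map_mul]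
    exact X.lift.mapsTo ((Subgroup.mem_normalizer_iff.mp hf γ').mp hγ')
  refine Subgroup.mem_normalizer_iff.mpr fun γ => ⟨key f hf γ, fun h => ?_⟩
  have := key f⁻¹ (inv_mem hf) _ h
  simpa [mul_assoc] using this

namespace SpinSymmetry

variable (φ : X.SpinSymmetry)

/-- An element `f` of the normalizer of `Γ` in `SO⁺(4,1)` with `φ = f_⋆`. It is unique up to left
multiplication by elements of `Γ`. -/
def rep : SOplus := eta φ.exists_rep.choose

theorem rep_mem : φ.rep ∈ Subgroup.normalizer (X.Γ : Set SOplus) :=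
  eta_mem_normalizer φ.exists_rep.choose_spec.1

theorem base_pt (x : H4) : φ.base (X.pt x) = X.pt (φ.rep • x) :=
  φ.exists_rep.choose_spec.2.2 x

theorem base_injective : Function.Injective φ.base := by
  intro P Q h
  induction P using Quotient.inductionOn with | _ x
  induction Q using Quotient.inductionOn with | _ y
  change φ.base (X.pt x) = φ.base (X.pt y) at h
  rw [base_pt, base_pt, pt_eq_iff] at h
  obtain ⟨γ, hγ, h⟩ := h
  refine X.pt_eq_iff.mpr ⟨φ.rep⁻¹ * γ * φ.rep,
    (Subgroup.mem_normalizer_iff''.mp φ.rep_mem γ).mp hγ, ?_⟩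
  rw [mul_smul, mul_smul, h, inv_smul_smul]

theorem proj_bundleMap (u : X.SpinBundle) : X.proj (φ.bundleMap u) = φ.base (X.proj u) := by
  obtain ⟨f, -, h1, h2⟩ := φ.exists_rep
  induction u using Quotient.inductionOn with | _ g
  change X.proj (φ.bundleMap (X.spinPt g)) = φ.base (X.pt (eta g • basePt))
  rw [h1, h2, ← mul_smul, ← map_mul]
  rfl

theorem bundleMap_rmul (s : Spin4) (u : X.SpinBundle) :
    φ.bundleMap (X.rmul s u) = X.rmul s (φ.bundleMap u) := by
  obtain ⟨f, -, h1, -⟩ := φ.exists_rep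
  induction u using Quotient.inductionOn with | _ g
  change φ.bundleMap (X.spinPt (g * s)) = X.rmul s (φ.bundleMap (X.spinPt g))
  rw [h1, h1, ← mul_assoc]
  rfl

theorem proj_symm {P : X.M} (hP : φ.base P = P) {u : X.SpinBundle} (hu : X.proj u = P) :
    X.proj (φ.bundleMap.symm u) = P := by
  apply φ.base_injective
  rw [← proj_bundleMap, Equiv.apply_symm_apply, hu, hP]

theorem pt_inv_smul {P : X.M} (hP : φ.base P = P) {y : H4} (hy : X.pt y = P) :
    X.pt (φ.rep⁻¹ • y) = P := by
  apply φ.base_injective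
  rw [base_pt, smul_inv_smul, hy, hP]

end SpinSymmetry

/-! ### The complex spin representations of `Spin(4)` -/

/-- The embedding `a + b j ↦ !![a, b; -b̄, ā]` (`a`, `b` complex) of `ℍ` into `ℂ(2)`. -/
def psi1 (q : ℍ[ℝ]) : Matrix (Fin 2) (Fin 2) ℂ :=
  !![⟨q.re, q.imI⟩, ⟨q.imJ, q.imK⟩; -⟨q.imJ, -q.imK⟩, ⟨q.re, -q.imI⟩]

/-- The induced embedding of `ℍ(2)` into `ℂ(4)`, written in `2 × 2` blocks. -/
def psi2 (A : Matrix (Fin 2) (Fin 2) ℍ[ℝ]) : Matrix (Fin 2 ⊕ Fin 2) (Fin 2 ⊕ Fin 2) ℂ :=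
  Matrix.fromBlocks (psi1 (A 0 0)) (psi1 (A 0 1)) (psi1 (A 1 0)) (psi1 (A 1 1))

/-- The space `ℂ⁴` of complex spinors. -/
abbrev Spinor : Type := Fin 2 ⊕ Fin 2 → ℂ

/-- The complex spin representation `Δ₄` of `Spin(4)` on `ℂ⁴`. -/
def spinRep (s : Spin4) : Matrix (Fin 2 ⊕ Fin 2) (Fin 2 ⊕ Fin 2) ℂ := psi2 (mat s)

/-- Clifford multiplication by a vector `x` of `ℝ^{4,1}`, as a quaternionic matrix. It satisfies
`E(x)² = -⟨x,x⟩` and `A E(x) A⁻¹ = E(η(A)x)` for `A` in `SU(1,1;ℍ)`, and `E(e₅) = -J`. -/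
def cliff (x : Fin 5 → ℝ) : Matrix (Fin 2) (Fin 2) ℍ[ℝ] := -(herm x * Jmat)

theorem cliff_sq (x : Fin 5 → ℝ) :
    cliff x * cliff x = (-lor x x) • (1 : Matrix (Fin 2) (Fin 2) ℍ[ℝ]) := by
  rw [cliff, neg_mul_neg, ← herm_sq]
  simp only [mul_assoc]

theorem mat_mul_cliff (A : SU11) (x : Fin 5 → ℝ) :
    mat A * cliff x = cliff (etaMat (mat A) *ᵥ x) * mat A := by
  have h : mat A * (herm x * Jmat) = herm (etaMat (mat A) *ᵥ x) * Jmat * mat A := by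
    rw [← herm_eta]
    calc mat A * (herm x * Jmat) = mat A * herm x * ((mat A)ᴴ * Jmat * mat A) := by
          rw [star_mat_mul, mul_assoc]
      _ = _ := by simp only [mul_assoc]
  rw [cliff, cliff, mul_neg, neg_mul, h]

/-- Clifford multiplication on spinors by the standard basis vector `e_j` of `ℝ⁴`. -/
def cliffBasis (j : Fin 4) : Matrix (Fin 2 ⊕ Fin 2) (Fin 2 ⊕ Fin 2) ℂ :=
  psi2 (cliff (Pi.single j.castSucc 1))

/-- The chirality operator `i² e₁e₂e₃e₄` on spinors; its `+1` and `-1` eigenspaces are the spaces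
`W⁺` and `W⁻` of positive and negative spinors, on which `Spin(4)` acts by `Δ₄⁺` and `Δ₄⁻`. -/
def chirality : Matrix (Fin 2 ⊕ Fin 2) (Fin 2 ⊕ Fin 2) ℂ :=
  Complex.I ^ 2 • (cliffBasis 0 * cliffBasis 1 * cliffBasis 2 * cliffBasis 3)

/-! ### The contribution of a fixed point -/

variable (X) in
/-- The fibre over `P` of the bundle of positive (`ε = 1`) or negative (`ε = -1`) spinors, which is
associated to the spin structure by `Δ₄⁺` or `Δ₄⁻`. A spinor at `P` assigns to each spin frame `u`
over `P` a vector `ψ(u)` of `W^±` such that `ψ(us) = Δ₄(s)⁻¹ψ(u)` for `s` in `Spin(4)`. -/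
def spinorFibre (P : X.M) (ε : ℤˣ) : Submodule ℂ ({u : X.SpinBundle // X.proj u = P} → Spinor) where
  carrier := {ψ | (∀ u v (s : Spin4), v.1 = X.rmul s u.1 → ψ v = spinRep s⁻¹ *ᵥ ψ u) ∧
    ∀ u, chirality *ᵥ ψ u = ((ε : ℤ) : ℂ) • ψ u}
  add_mem' := by
    rintro ψ χ ⟨h1, h2⟩ ⟨k1, k2⟩
    refine ⟨fun u v s h => ?_, fun u => ?_⟩
    · rw [Pi.add_apply, Pi.add_apply, Matrix.mulVec_add, h1 u v s h, k1 u v s h]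
    · rw [Pi.add_apply, Matrix.mulVec_add, smul_add, h2, k2]
  zero_mem' := ⟨fun u v s _ => by simp, fun u => by simp⟩
  smul_mem' := by
    rintro c ψ ⟨h1, h2⟩
    refine ⟨fun u v s h => ?_, fun u => ?_⟩
    · rw [Pi.smul_apply, Pi.smul_apply, Matrix.mulVec_smul, h1 u v s h]
    · rw [Pi.smul_apply, Matrix.mulVec_smul, h2, smul_comm]

/-- The action of `φ̂` on the positive or negative spinors at a fixed point `P` of `φ`, given by
`(φ̂ψ)(u) = ψ(φ̂⁻¹(u))`. -/
def spinorAction (φ : X.SpinSymmetry) {P : X.M} (hP : φ.base P = P) (ε : ℤˣ) :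
    X.spinorFibre P ε →ₗ[ℂ] X.spinorFibre P ε where
  toFun ψ := ⟨fun u => ψ.1 ⟨φ.bundleMap.symm u.1, φ.proj_symm hP u.2⟩,
    fun u v s h => ψ.2.1 _ _ s (by
      rw [Equiv.symm_apply_eq, φ.bundleMap_rmul, Equiv.apply_symm_apply]
      exact h),
    fun u => ψ.2.2 _⟩
  map_add' _ _ := rfl
  map_smul' _ _ := rfl

variable (X) in
/-- The tangent space of `M = Γ\H⁴` at `P`. A tangent vector at `P` is a `Γ`-equivariant choice of a
tangent vector `ξ(y)` of `H⁴` (a vector Lorentz orthogonal to `y`) at each point `y` over `P`. -/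
def tangentSpace (P : X.M) : Submodule ℝ ({y : H4 // X.pt y = P} → Fin 5 → ℝ) where
  carrier := {ξ | (∀ y, lor y.1.1 (ξ y) = 0) ∧
    ∀ y z, ∀ γ ∈ X.Γ, z.1 = γ • y.1 → ξ z = rmat γ *ᵥ ξ y}
  add_mem' := by
    rintro ξ ζ ⟨h1, h2⟩ ⟨k1, k2⟩
    refine ⟨fun y => ?_, fun y z γ hγ h => ?_⟩
    · have h := h1 y
      have k := k1 y
      simp only [lor, Pi.add_apply] at h k ⊢
      linarith
    · rw [Pi.add_apply, Pi.add_apply, Matrix.mulVec_add, h2 y z γ hγ h, k2 y z γ hγ h]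
  zero_mem' := ⟨fun y => by simp [lor], fun y z γ _ _ => by simp⟩
  smul_mem' := by
    rintro c ξ ⟨h1, h2⟩
    refine ⟨fun y => ?_, fun y z γ hγ h => ?_⟩
    · have h := h1 y
      simp only [lor, Pi.smul_apply, smul_eq_mul] at h ⊢
      linear_combination c * h
    · rw [Pi.smul_apply, Pi.smul_apply, Matrix.mulVec_smul, h2 y z γ hγ h]

/-- The differential `dφ_P` of `φ = f_⋆` at a fixed point `P`: the tangent vector of `M` represented
by the vector `v` at `y` is mapped to the one represented by `fv` at `fy`. -/
def differential (φ : X.SpinSymmetry) {P : X.M} (hP : φ.base P = P) :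
    X.tangentSpace P →ₗ[ℝ] X.tangentSpace P where
  toFun ξ := ⟨fun y => rmat φ.rep *ᵥ ξ.1 ⟨φ.rep⁻¹ • y.1, φ.pt_inv_smul hP y.2⟩,
    fun y => by
      have h := ξ.2.1 ⟨φ.rep⁻¹ • y.1, φ.pt_inv_smul hP y.2⟩
      rw [← φ.rep.2.1] at h
      have e : rmat φ.rep *ᵥ (φ.rep⁻¹ • y.1).1 = y.1.1 := congrArg Subtype.val (smul_inv_smul φ.rep y.1)
      rwa [e] at h,
    fun y z γ hγ h => by
      have k := ξ.2.2 ⟨φ.rep⁻¹ • y.1, φ.pt_inv_smul hP y.2⟩ ⟨φ.rep⁻¹ • z.1, φ.pt_inv_smul hP z.2⟩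
        (φ.rep⁻¹ * γ * φ.rep) ((Subgroup.mem_normalizer_iff''.mp φ.rep_mem γ).mp hγ) (by
          simp only [h, mul_smul, smul_inv_smul])
      have e : rmat φ.rep * rmat (φ.rep⁻¹ * γ * φ.rep) = rmat γ * rmat φ.rep := by
        have : φ.rep * (φ.rep⁻¹ * γ * φ.rep) = γ * φ.rep := by group
        exact congrArg rmat this
      change rmat φ.rep *ᵥ ξ.1 _ = rmat γ *ᵥ (rmat φ.rep *ᵥ ξ.1 _)
      rw [k, Matrix.mulVec_mulVec, e, ← Matrix.mulVec_mulVec]⟩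
  map_add' ξ ζ := Subtype.ext (funext fun _ => Matrix.mulVec_add (rmat φ.rep) (ξ.1 _) (ζ.1 _))
  map_smul' c ξ := Subtype.ext (funext fun _ => Matrix.mulVec_smul (rmat φ.rep) c (ξ.1 _))

/-- The contribution `ν(φ̂, P)` of a fixed point `P` of `φ` to the `G`-index `Spin(φ̂, M)`, as in the
Atiyah-Bott fixed point formula: the difference of the traces of `φ̂` on the positive and the negative
spinors at `P`, divided by `|det(I - dφ_P)|`. -/
def nu (φ : X.SpinSymmetry) (P : X.M) (hP : φ.base P = P) : ℂ :=
  (LinearMap.trace ℂ _ (spinorAction φ hP 1) - LinearMap.trace ℂ _ (spinorAction φ hP (-1))) /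
    ((|LinearMap.det (LinearMap.id - differential φ hP)| : ℝ) : ℂ)

end SpinClosedHyperbolic4

end SpinHyp

end

/-! The element γf fixes x = ge₅, so s = ĝ⁻¹γ̂f̂ĝ lies over the stabilizer of e₅ and has the form
diag(p, q) with p and q unit quaternions (`mat_eq_diag_of_mem_Spin4`). Everything at P can be read
off in the frames ĝ and g, where φ̂ and φ become s and η(s).

Numerator: the spin frame Γ̂ĝ is sent to itself times s, because γ̂ is absorbed on the left.
Evaluation at this frame identifies the spinors at P with ℂ⁴ and the action of φ̂ with Δ₄(s). The
chirality operator is diag(1, 1, -1, -1), so S⁺ and S⁻ are the two copies of ℂ², on which p and q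
act with traces 2Re(p) and 2Re(q) (`trace_spinorAction_one`, `trace_spinorAction_neg_one`).

Denominator: in the frame g the differential is the rotation v ↦ p v q̄ of ℝ⁴ = ℍ, and det(I - dφ_P)
= 4(Re(p) - Re(q))² (`det_id_sub_differential`, `det_one_sub_rotMat`). This is nonnegative, so the
absolute value is harmless, and the quotient is 1/(2(Re(p) - Re(q))).

It remains to see that Re(p) ≠ Re(q) (`re_ne_re_of_isolated`). Otherwise the rotation fixes some v ≠
0, hence γf fixes a geodesic through x pointwise. Its image in M consists of fixed points of φ.
Since P is isolated, a short piece of the geodesic would lie over P, but that fibre is a Γ-orbit,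
which is countable. -/

namespace SpinHyp

open SpinClosedHyperbolic4

/-! ### The stabilizer of e₅ and the rotations v ↦ p v q̄ -/

/-- An element of `Spin(4)` is a diagonal matrix of unit quaternions. -/
theorem mat_eq_diag_of_mem_Spin4 {A : SU11} (hA : A ∈ Spin4) :
    ∃ p q : ℍ[ℝ], ‖p‖ = 1 ∧ ‖q‖ = 1 ∧ mat A = !![p, 0; 0, q] := by
  have hfix : etaMat (mat A) *ᵥ basePt.1 = basePt.1 := congrArg Subtype.val hA
  have h1 := star_mat_mul A
  have h2 := mat_mul_star A
  have h3 := herm_eta A basePt.1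
  rw [hfix] at h3
  -- Since H(e₅) = I, fixing e₅ means AA* = I. Comparing diagonal entries with AJA* = J gives |a|² +
  -- |b|² = 1 = |a|² - |b|² and |d|² + |c|² = 1 = |d|² - |c|².
  have hb : herm basePt.1 = 1 := by
    ext i j <;> fin_cases i <;> fin_cases j <;> simp [herm, basePt]
  rw [hb, mul_one] at h3
  generalize mat A = M at *
  obtain ⟨a, b, c, d, rfl⟩ : ∃ a b c d, M = !![a, b; c, d] :=
    ⟨_, _, _, _, Matrix.eta_fin_two M⟩
  obtain ⟨-, -, -, l1, -, l3⟩ := su_rel h1 h2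
  rw [fin_two_conjTranspose, Matrix.mul_fin_two] at h3
  have m00 := congrFun (congrFun h3 0) 0
  have m11 := congrFun (congrFun h3 1) 1
  simp only [Matrix.of_apply, Matrix.cons_val, Matrix.one_apply_eq] at m00 m11
  simp only [Quaternion.self_mul_star] at l1 l3 m00 m11
  have l1 := congrArg QuaternionAlgebra.re l1
  have l3 := congrArg QuaternionAlgebra.re l3
  have m00 := congrArg QuaternionAlgebra.re m00
  have m11 := congrArg QuaternionAlgebra.re m11
  simp only [Quaternion.re_sub, Quaternion.re_add, Quaternion.re_coe, Quaternion.re_one,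
    Quaternion.re_neg] at l1 l3 m00 m11
  have hb : b = 0 := Quaternion.normSq_eq_zero.mp (by linarith)
  have hc : c = 0 := Quaternion.normSq_eq_zero.mp (by linarith)
  have key : ∀ r : ℍ[ℝ], Quaternion.normSq r = 1 → ‖r‖ = 1 := fun r hr => by
    rw [Quaternion.normSq_eq_norm_mul_self] at hr
    nlinarith [norm_nonneg r]
  exact ⟨a, d, key a (by linarith), key d (by linarith), by rw [hb, hc]⟩

/-- The matrix of `v ↦ p v q̄` on `ℝ⁴`. -/
noncomputable def rotMat (p q : ℍ[ℝ]) : Matrix (Fin 4) (Fin 4) ℝ :=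
  (etaMat !![p, 0; 0, q]).submatrix Fin.castSucc Fin.castSucc

theorem normSq_eq_one {p : ℍ[ℝ]} (hp : ‖p‖ = 1) : Quaternion.normSq p = 1 := by
  rw [Quaternion.normSq_eq_norm_mul_self, hp, one_mul]

/-- If Re(p) = cos α and Re(q) = cos β, the rotation turns two orthogonal planes by the angles α + β
and α - β. The determinant is therefore (2 - 2cos(α + β))(2 - 2cos(α - β)) = 4(cos α - cos β)². -/
theorem det_one_sub_rotMat {p q : ℍ[ℝ]} (hp : ‖p‖ = 1) (hq : ‖q‖ = 1) :
    (1 - rotMat p q).det = 4 * (p.re - q.re) ^ 2 := by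
  -- With the squared norms kept as polynomials in the coordinates, this identity holds for all p
  -- and q and needs no side condition.
  have h : (1 - rotMat p q).det =
      (1 + Quaternion.normSq p * Quaternion.normSq q) ^ 2 -
        4 * (1 + Quaternion.normSq p * Quaternion.normSq q) * p.re * q.re +
        4 * (Quaternion.normSq p * q.re ^ 2 + Quaternion.normSq q * p.re ^ 2 -
          Quaternion.normSq p * Quaternion.normSq q) := by
    simp [rotMat, etaMat, Matrix.det_succ_row_zero, Fin.sum_univ_succ, Fin.succAbove,
      Quaternion.normSq_def', Matrix.one_apply]
    ring
  rw [h, normSq_eq_one hp, normSq_eq_one hq]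
  ring

theorem etaMat_diag_mulVec_castSucc (p q : ℍ[ℝ]) (y : Fin 5 → ℝ) (i : Fin 4) :
    (etaMat !![p, 0; 0, q] *ᵥ y) i.castSucc = (rotMat p q *ᵥ fun j => y j.castSucc) i := by
  rw [Matrix.mulVec, Matrix.mulVec, dotProduct, dotProduct, Fin.sum_univ_castSucc]
  have : etaMat !![p, 0; 0, q] i.castSucc (Fin.last 4) = 0 := by
    fin_cases i <;> simp [etaMat, Fin.last]
  rw [this, zero_mul, add_zero]
  rfl

theorem etaMat_diag_mulVec_last {p q : ℍ[ℝ]} (hp : ‖p‖ = 1) (y : Fin 5 → ℝ) :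
    (etaMat !![p, 0; 0, q] *ᵥ y) 4 = y 4 := by
  have h := normSq_eq_one hp
  rw [Quaternion.normSq_def'] at h
  simp [etaMat, Matrix.mulVec, dotProduct, Fin.sum_univ_five, h]

/-! ### Chirality and the spin representation in blocks -/

/-- The basis vector e_j, viewed as a quaternion v, acts by the block matrix with rows (0, v) and
(-v̄, 0). The product e₁e₂e₃e₄ thus has diagonal blocks ijk = -1 and -ijk = 1, and the factor i² =
-1 exchanges the signs. This is what attaches p to the positive spinors and q to the negative ones.
-/
theorem chirality_eq : chirality = Matrix.fromBlocks 1 0 0 (-1) := by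
  have h : ∀ j, cliffBasis j = Matrix.fromBlocks 0 (psi1 (cliff (Pi.single j.castSucc 1) 0 1))
      (psi1 (cliff (Pi.single j.castSucc 1) 1 0)) 0 := by
    intro j
    rw [cliffBasis, psi2]
    congr 1 <;> fin_cases j <;> ext a b <;> fin_cases a <;> fin_cases b <;>
      simp [psi1, cliff, herm, Jmat, Complex.ext_iff]
  rw [chirality, h, h, h, h]
  simp only [Matrix.fromBlocks_multiply, Matrix.fromBlocks_smul]
  congr 1 <;> ext a b <;> fin_cases a <;> fin_cases b <;>
    simp [psi1, cliff, herm, Jmat, Complex.ext_iff]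

theorem chirality_mulVec_inl (w : Spinor) (i : Fin 2) :
    (chirality *ᵥ w) (Sum.inl i) = w (Sum.inl i) := by
  simp [chirality_eq, Matrix.fromBlocks_mulVec]

theorem chirality_mulVec_inr (w : Spinor) (i : Fin 2) :
    (chirality *ᵥ w) (Sum.inr i) = -w (Sum.inr i) := by
  simp [chirality_eq, Matrix.fromBlocks_mulVec, Matrix.neg_mulVec]

theorem trace_psi1 (p : ℍ[ℝ]) : (psi1 p).trace = 2 * p.re := by
  simp [psi1, Matrix.trace_fin_two, Complex.ext_iff]
  ring

theorem psi1_zero : psi1 0 = 0 := by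
  ext a b; fin_cases a <;> fin_cases b <;> simp [psi1, Complex.ext_iff]

theorem psi1_one : psi1 1 = 1 := by
  ext a b; fin_cases a <;> fin_cases b <;> simp [psi1, Complex.ext_iff]

theorem psi1_add (p q : ℍ[ℝ]) : psi1 (p + q) = psi1 p + psi1 q := by
  ext a b; fin_cases a <;> fin_cases b <;> simp [psi1, Complex.ext_iff] <;> ring

theorem psi1_mul (p q : ℍ[ℝ]) : psi1 (p * q) = psi1 p * psi1 q := by
  ext a b; fin_cases a <;> fin_cases b <;>
    simp [psi1, Complex.ext_iff, Matrix.mul_apply, Fin.sum_univ_two] <;>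
    constructor <;> ring

theorem spinRep_one : spinRep 1 = 1 := by
  change psi2 (1 : Matrix (Fin 2) (Fin 2) ℍ[ℝ]) = 1
  simp [psi2, psi1_zero, psi1_one]

theorem spinRep_mul (s t : Spin4) : spinRep (s * t) = spinRep s * spinRep t := by
  change psi2 (mat s * mat t) = psi2 (mat s) * psi2 (mat t)
  simp [psi2, Matrix.fromBlocks_multiply, Matrix.mul_apply, Fin.sum_univ_two, psi1_add, psi1_mul]

theorem spinRep_eq_fromBlocks {s : Spin4} {p q : ℍ[ℝ]} (h : mat s = !![p, 0; 0, q]) :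
    spinRep s = Matrix.fromBlocks (psi1 p) 0 0 (psi1 q) := by
  simp [spinRep, psi2, h, psi1_zero]

theorem spinRep_mulVec_inl {s : Spin4} {p q : ℍ[ℝ]} (h : mat s = !![p, 0; 0, q]) (w : Spinor)
    (i : Fin 2) : (spinRep s *ᵥ w) (Sum.inl i) = (psi1 p *ᵥ fun j => w (Sum.inl j)) i := by
  simp only [spinRep_eq_fromBlocks h, Matrix.fromBlocks_mulVec, Sum.elim_inl, Matrix.zero_mulVec,
    add_zero]
  rfl

theorem spinRep_mulVec_inr {s : Spin4} {p q : ℍ[ℝ]} (h : mat s = !![p, 0; 0, q]) (w : Spinor)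
    (i : Fin 2) : (spinRep s *ᵥ w) (Sum.inr i) = (psi1 q *ᵥ fun j => w (Sum.inr j)) i := by
  simp only [spinRep_eq_fromBlocks h, Matrix.fromBlocks_mulVec, Sum.elim_inr, Matrix.zero_mulVec,
    zero_add]
  rfl

/-- The chirality operator commutes with `Spin(4)`. -/
theorem chirality_mulVec_spinRep (s : Spin4) (w : Spinor) :
    chirality *ᵥ (spinRep s *ᵥ w) = spinRep s *ᵥ (chirality *ᵥ w) := by
  obtain ⟨p, q, -, -, h⟩ := mat_eq_diag_of_mem_Spin4 s.2
  rw [Matrix.mulVec_mulVec, Matrix.mulVec_mulVec, spinRep_eq_fromBlocks h, chirality_eq]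
  simp [Matrix.fromBlocks_multiply]

/-! ### The spin structure as a principal `Spin(4)`-bundle -/

namespace SpinClosedHyperbolic4

variable {X : SpinClosedHyperbolic4}

theorem rmul_rmul (s t : Spin4) (u : X.SpinBundle) :
    X.rmul t (X.rmul s u) = X.rmul (s * t) u := by
  induction u using Quotient.inductionOn with | _ g
  change X.spinPt (g * s * t) = X.spinPt (g * (s * t))
  rw [mul_assoc]

theorem rmul_one (u : X.SpinBundle) : X.rmul 1 u = u := by
  induction u using Quotient.inductionOn with | _ g
  change X.spinPt (g * 1) = X.spinPt g
  rw [mul_one]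

theorem proj_spinPt (g : SU11) : X.proj (X.spinPt g) = X.pt (eta g • basePt) := rfl

/-- `Spin(4)` acts transitively on the fibres of the spin structure. -/
theorem exists_eq_rmul {u v : X.SpinBundle} (h : X.proj u = X.proj v) :
    ∃ s : Spin4, u = X.rmul s v := by
  induction u using Quotient.inductionOn with | _ k
  induction v using Quotient.inductionOn with | _ g
  change X.proj (X.spinPt k) = X.proj (X.spinPt g) at h
  rw [proj_spinPt, proj_spinPt, pt_eq_iff] at h
  obtain ⟨γ, hγ, h⟩ := h
  obtain ⟨μ, hμ, rfl⟩ := X.lift.surjOn hγ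
  -- Here μ carries the point ge₅ to ke₅, so μ⁻¹k represents the same frame as k but lies over the
  -- same point of H⁴ as g.
  refine ⟨⟨g⁻¹ * μ⁻¹ * k, ?_⟩, ?_⟩
  · change eta (g⁻¹ * μ⁻¹ * k) • basePt = basePt
    rw [map_mul, mul_smul, ← h, map_mul, map_inv, map_inv, mul_smul, inv_smul_smul, inv_smul_smul]
  · change X.spinPt k = X.spinPt (g * (g⁻¹ * μ⁻¹ * k))
    exact X.spinPt_eq_iff.mpr ⟨μ, hμ, by group⟩

/-- `Spin(4)` acts freely on the spin structure. -/
theorem rmul_left_injective (u : X.SpinBundle) : Function.Injective fun s => X.rmul s u := by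
  intro s t h
  induction u using Quotient.inductionOn with | _ g
  change X.spinPt (g * s) = X.spinPt (g * t) at h
  obtain ⟨μ, hμ, h⟩ := X.spinPt_eq_iff.mp h
  have hs : ∀ s : Spin4, eta (s : SU11) • basePt = basePt := fun s => s.2
  -- Both s and t fix e₅, so applying μgt = gs to e₅ gives a fixed point of η(μ). Freeness of Γ and
  -- injectivity of η on Γ̂ then force μ = 1.
  have h1 : eta μ • eta g • basePt = eta g • basePt := by
    have := congrArg (fun a => eta a • basePt) h
    simpa only [map_mul, mul_smul, hs] using this
  have h2 : μ = 1 := by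
    have := X.free _ (X.lift.mapsTo hμ) _ h1
    exact X.lift.injOn hμ (one_mem X.Γh) (by rw [this, map_one])
  rw [h2, one_mul] at h
  exact Subtype.ext (mul_left_cancel h).symm

/-! ### Traces on the spinors at a fixed point -/

section Spinors

variable {P : X.M} {ε : ℤˣ} (u₀ : {u : X.SpinBundle // X.proj u = P})

theorem spinorFibre_ext {ψ χ : X.spinorFibre P ε} (h : ψ.1 u₀ = χ.1 u₀) : ψ = χ := by
  refine Subtype.ext (funext fun u => ?_)
  obtain ⟨s, hs⟩ := exists_eq_rmul (u.2.trans u₀.2.symm)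
  rw [ψ.2.1 u₀ u s hs, χ.2.1 u₀ u s hs, h]

/-- Each frame over P is u₀s for exactly one s, so ψ(u₀s) = Δ₄(s)⁻¹w defines an equivariant
function. It keeps the chirality of w because chirality commutes with `Spin(4)`. -/
theorem exists_spinor_eq {w : Spinor} (hw : chirality *ᵥ w = ((ε : ℤ) : ℂ) • w) :
    ∃ ψ : X.spinorFibre P ε, ψ.1 u₀ = w := by
  have hex : ∀ u : {u : X.SpinBundle // X.proj u = P}, ∃ s : Spin4, u.1 = X.rmul s u₀.1 :=
    fun u => exists_eq_rmul (u.2.trans u₀.2.symm)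
  choose s hs using hex
  refine ⟨⟨fun u => spinRep (s u)⁻¹ *ᵥ w, fun u v t h => ?_, fun u => ?_⟩, ?_⟩
  · change spinRep (s v)⁻¹ *ᵥ w = spinRep t⁻¹ *ᵥ (spinRep (s u)⁻¹ *ᵥ w)
    -- Freeness makes the chosen s compatible with right multiplication, which is the equivariance
    -- required of ψ.
    have : s v = s u * t := rmul_left_injective u₀.1 (by
      change X.rmul (s v) u₀.1 = X.rmul (s u * t) u₀.1
      rw [← hs, h, hs u, rmul_rmul])
    rw [this, mul_inv_rev, spinRep_mul, Matrix.mulVec_mulVec]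
  · rw [chirality_mulVec_spinRep, hw, Matrix.mulVec_smul]
  · have : s u₀ = 1 := rmul_left_injective u₀.1 (by
      change X.rmul (s u₀) u₀.1 = X.rmul 1 u₀.1
      rw [← hs, rmul_one])
    change spinRep (s u₀)⁻¹ *ᵥ w = w
    rw [this, inv_one, spinRep_one, Matrix.one_mulVec]

/-- The fibre of the positive spinors, identified with `ℂ²` by means of a spin frame. -/
noncomputable def positiveSpinorEquiv : X.spinorFibre P 1 ≃ₗ[ℂ] (Fin 2 → ℂ) :=
  LinearEquiv.ofBijective
    { toFun := fun ψ i => ψ.1 u₀ (Sum.inl i)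
      map_add' := fun _ _ => rfl
      map_smul' := fun _ _ => rfl } (by
    constructor
    · intro ψ χ h
      refine spinorFibre_ext u₀ (funext fun i => ?_)
      rcases i with i | i
      · exact congrFun h i
      · have key : ∀ ψ : X.spinorFibre P 1, ψ.1 u₀ (Sum.inr i) = 0 := fun ψ => by
          have := congrFun (ψ.2.2 u₀) (Sum.inr i)
          rw [chirality_mulVec_inr] at this
          simpa using self_eq_neg.mp (this.trans (by simp)).symm
        rw [key, key]
    · intro w
      obtain ⟨ψ, hψ⟩ := exists_spinor_eq (ε := 1) u₀ (w := Sum.elim w 0) (by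
        ext i
        rcases i with i | i
        · simp [chirality_mulVec_inl]
        · simp [chirality_mulVec_inr])
      exact ⟨ψ, funext fun i => congrFun hψ (Sum.inl i)⟩)

/-- The fibre of the negative spinors, identified with `ℂ²` by means of a spin frame. -/
noncomputable def negativeSpinorEquiv : X.spinorFibre P (-1) ≃ₗ[ℂ] (Fin 2 → ℂ) :=
  LinearEquiv.ofBijective
    { toFun := fun ψ i => ψ.1 u₀ (Sum.inr i)
      map_add' := fun _ _ => rfl
      map_smul' := fun _ _ => rfl } (by
    constructor
    · intro ψ χ h
      refine spinorFibre_ext u₀ (funext fun i => ?_)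
      rcases i with i | i
      · have key : ∀ ψ : X.spinorFibre P (-1), ψ.1 u₀ (Sum.inl i) = 0 := fun ψ => by
          have := congrFun (ψ.2.2 u₀) (Sum.inl i)
          rw [chirality_mulVec_inl] at this
          simpa using self_eq_neg.mp (this.trans (by simp))
        rw [key, key]
      · exact congrFun h i
    · intro w
      obtain ⟨ψ, hψ⟩ := exists_spinor_eq (ε := -1) u₀ (w := Sum.elim 0 w) (by
        ext i
        rcases i with i | i
        · simp [chirality_mulVec_inl]
        · simp [chirality_mulVec_inr])
      exact ⟨ψ, funext fun i => congrFun hψ (Sum.inr i)⟩)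

/-- From φ̂(u₀) = u₀s one gets φ̂⁻¹(u₀) = u₀s⁻¹. The inverse in the definition of the action and the
one in the equivariance rule cancel, leaving Δ₄(s). -/
theorem spinorAction_apply {φ : X.SpinSymmetry} (hP : φ.base P = P) {s : Spin4}
    (hs : φ.bundleMap u₀.1 = X.rmul s u₀.1) (ψ : X.spinorFibre P ε) :
    (spinorAction φ hP ε ψ).1 u₀ = spinRep s *ᵥ ψ.1 u₀ := by
  change ψ.1 ⟨φ.bundleMap.symm u₀.1, φ.proj_symm hP u₀.2⟩ = _
  rw [ψ.2.1 u₀ _ s⁻¹, inv_inv]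
  rw [Equiv.symm_apply_eq, φ.bundleMap_rmul, hs, rmul_rmul, mul_inv_cancel, rmul_one]

theorem trace_spinorAction_one {φ : X.SpinSymmetry} (hP : φ.base P = P) {s : Spin4}
    (hs : φ.bundleMap u₀.1 = X.rmul s u₀.1) {p q : ℍ[ℝ]} (h : mat s = !![p, 0; 0, q]) :
    LinearMap.trace ℂ _ (spinorAction φ hP 1) = 2 * p.re := by
  have hc : (positiveSpinorEquiv u₀).conj (spinorAction φ hP 1) = Matrix.toLin' (psi1 p) := by
    refine LinearMap.ext fun w => ?_
    obtain ⟨ψ, rfl⟩ := (positiveSpinorEquiv u₀).surjective w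
    rw [LinearEquiv.conj_apply_apply, LinearEquiv.symm_apply_apply, Matrix.toLin'_apply]
    refine funext fun i => ?_
    change (spinorAction φ hP 1 ψ).1 u₀ (Sum.inl i) = _
    rw [spinorAction_apply u₀ hP hs, spinRep_mulVec_inl h]
    rfl
  rw [← LinearMap.trace_conj' _ (positiveSpinorEquiv u₀), hc, Matrix.trace_toLin'_eq, trace_psi1]

theorem trace_spinorAction_neg_one {φ : X.SpinSymmetry} (hP : φ.base P = P) {s : Spin4}
    (hs : φ.bundleMap u₀.1 = X.rmul s u₀.1) {p q : ℍ[ℝ]} (h : mat s = !![p, 0; 0, q]) :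
    LinearMap.trace ℂ _ (spinorAction φ hP (-1)) = 2 * q.re := by
  have hc : (negativeSpinorEquiv u₀).conj (spinorAction φ hP (-1)) = Matrix.toLin' (psi1 q) := by
    refine LinearMap.ext fun w => ?_
    obtain ⟨ψ, rfl⟩ := (negativeSpinorEquiv u₀).surjective w
    rw [LinearEquiv.conj_apply_apply, LinearEquiv.symm_apply_apply, Matrix.toLin'_apply]
    refine funext fun i => ?_
    change (spinorAction φ hP (-1) ψ).1 u₀ (Sum.inr i) = _
    rw [spinorAction_apply u₀ hP hs, spinRep_mulVec_inr h]
    rfl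
  rw [← LinearMap.trace_conj' _ (negativeSpinorEquiv u₀), hc, Matrix.trace_toLin'_eq, trace_psi1]

end Spinors

/-! ### The differential on the tangent space at a fixed point -/

section Tangent

variable {P : X.M}

theorem tangentSpace_ext (y₀ : {y : H4 // X.pt y = P}) {ξ ζ : X.tangentSpace P}
    (h : ξ.1 y₀ = ζ.1 y₀) : ξ = ζ := by
  refine Subtype.ext (funext fun y => ?_)
  obtain ⟨γ, hγ, hy⟩ := X.pt_eq_iff.mp (y.2.trans y₀.2.symm)
  rw [ξ.2.2 y₀ y γ hγ hy.symm, ζ.2.2 y₀ y γ hγ hy.symm, h]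

theorem eq_of_smul_eq_smul {γ δ : SOplus} (hγ : γ ∈ X.Γ) (hδ : δ ∈ X.Γ) {y : H4}
    (h : γ • y = δ • y) : γ = δ := by
  have := X.free (δ⁻¹ * γ) (mul_mem (inv_mem hδ) hγ) y (by rw [mul_smul, h, inv_smul_smul])
  exact (inv_mul_eq_one.mp this).symm

/-- By freeness the element of Γ carrying y₀ to a given point of the fibre is unique, so
transporting v by these elements is consistent with Γ-equivariance. -/
theorem exists_tangent_eq (y₀ : {y : H4 // X.pt y = P}) {v : Fin 5 → ℝ} (hv : lor y₀.1.1 v = 0) :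
    ∃ ξ : X.tangentSpace P, ξ.1 y₀ = v := by
  have hex : ∀ y : {y : H4 // X.pt y = P}, ∃ γ ∈ X.Γ, γ • y₀.1 = y.1 :=
    fun y => X.pt_eq_iff.mp (y.2.trans y₀.2.symm)
  choose δ hδ hy using hex
  refine ⟨⟨fun y => rmat (δ y) *ᵥ v, fun y => ?_, fun y z γ hγ h => ?_⟩, ?_⟩
  · have e : y.1.1 = rmat (δ y) *ᵥ y₀.1.1 := congrArg Subtype.val (hy y).symm
    rw [e, (δ y).2.1, hv]
  · have : δ z = γ * δ y := eq_of_smul_eq_smul (hδ z) (mul_mem hγ (hδ y)) (y := y₀.1) (by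
      rw [mul_smul, hy, hy, h])
    change rmat (δ z) *ᵥ v = rmat γ *ᵥ (rmat (δ y) *ᵥ v)
    rw [Matrix.mulVec_mulVec, this]
    rfl
  · have : δ y₀ = 1 := eq_of_smul_eq_smul (hδ y₀) (one_mem _) (y := y₀.1) (by rw [hy, one_smul])
    change rmat (δ y₀) *ᵥ v = v
    rw [this]
    exact Matrix.one_mulVec v

theorem rmat_inv_mulVec_rmat (g : SOplus) (v : Fin 5 → ℝ) : rmat g⁻¹ *ᵥ (rmat g *ᵥ v) = v := by
  rw [Matrix.mulVec_mulVec]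
  have : rmat g⁻¹ * rmat g = rmat (g⁻¹ * g) := rfl
  rw [this, inv_mul_cancel]
  exact Matrix.one_mulVec v

theorem rmat_mulVec_rmat_inv (g : SOplus) (v : Fin 5 → ℝ) : rmat g *ᵥ (rmat g⁻¹ *ᵥ v) = v := by
  simpa only [inv_inv] using rmat_inv_mulVec_rmat g⁻¹ v

theorem lor_basePt (v : Fin 5 → ℝ) : lor basePt.1 v = -v 4 := by
  simp [lor, basePt]

/-- The tangent space of `M` at `Γ(ge₅)`, identified with `ℝ⁴` by means of `g`. -/
noncomputable def tangentEquiv (g : SOplus) (hg : X.pt (g • basePt) = P) :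
    X.tangentSpace P ≃ₗ[ℝ] (Fin 4 → ℝ) :=
  LinearEquiv.ofBijective
    { toFun := fun ξ i => (rmat g⁻¹ *ᵥ ξ.1 ⟨g • basePt, hg⟩) i.castSucc
      map_add' := fun ξ ζ => by
        ext i
        exact congrFun (Matrix.mulVec_add (rmat g⁻¹) (ξ.1 _) (ζ.1 _)) i.castSucc
      map_smul' := fun c ξ => by
        ext i
        exact congrFun (Matrix.mulVec_smul (rmat g⁻¹) c (ξ.1 _)) i.castSucc } (by
    -- Tangency at ge₅ becomes, after applying g⁻¹, the vanishing of the last coordinate. The first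
    -- four coordinates are then free.
    have hlor : ∀ v, lor (g • basePt).1 (rmat g *ᵥ v) = -v 4 := fun v => by
      rw [← lor_basePt]
      exact g.2.1 _ _
    constructor
    · intro ξ ζ h
      have key : ∀ ξ : X.tangentSpace P, (rmat g⁻¹ *ᵥ ξ.1 ⟨g • basePt, hg⟩) 4 = 0 := fun ξ => by
        have := ξ.2.1 ⟨g • basePt, hg⟩
        rw [← rmat_mulVec_rmat_inv g (ξ.1 ⟨g • basePt, hg⟩), hlor] at this
        linarith
      refine tangentSpace_ext ⟨g • basePt, hg⟩ ?_
      rw [← rmat_mulVec_rmat_inv g (ξ.1 _), ← rmat_mulVec_rmat_inv g (ζ.1 _)]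
      congr 1
      refine funext fun i => ?_
      induction i using Fin.lastCases with
      | last => exact (key ξ).trans (key ζ).symm
      | cast i => exact congrFun h i
    · intro w
      obtain ⟨ξ, hξ⟩ := exists_tangent_eq (X := X) ⟨g • basePt, hg⟩
        (v := rmat g *ᵥ Fin.snoc (α := fun _ => ℝ) w 0) (by
          rw [hlor, neg_eq_zero]
          exact Fin.snoc_last (α := fun _ => ℝ) (0 : ℝ) w)
      refine ⟨ξ, funext fun i => ?_⟩
      change (rmat g⁻¹ *ᵥ ξ.1 ⟨g • basePt, hg⟩) i.castSucc = w i
      rw [hξ, rmat_inv_mulVec_rmat]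
      exact Fin.snoc_castSucc (α := fun _ => ℝ) (0 : ℝ) w i)

/-- If `h` fixes `y` and differs from the representative of `φ` by an element of `Γ`, then the
differential of `φ` at `Γy` is multiplication by `h` on the tangent vectors at `y`. -/
theorem differential_apply {φ : X.SpinSymmetry} (hP : φ.base P = P)
    (y : {y : H4 // X.pt y = P}) {h : SOplus} (hh : ∃ μ ∈ X.Γ, h = μ * φ.rep) (hy : h • y.1 = y.1)
    (ξ : X.tangentSpace P) : (differential φ hP ξ).1 y = rmat h *ᵥ ξ.1 y := by
  obtain ⟨μ, hμ, rfl⟩ := hh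
  change rmat φ.rep *ᵥ ξ.1 ⟨φ.rep⁻¹ • y.1, φ.pt_inv_smul hP y.2⟩ = _
  -- Writing r for `φ.rep`, the relation μry = y gives r⁻¹y = (r⁻¹μr)y with r⁻¹μr in Γ, so
  -- equivariance expresses ξ(r⁻¹y) through ξ(y).
  have hmem := (Subgroup.mem_normalizer_iff''.mp φ.rep_mem μ).mp hμ
  rw [ξ.2.2 y ⟨φ.rep⁻¹ • y.1, φ.pt_inv_smul hP y.2⟩ (φ.rep⁻¹ * μ * φ.rep) hmem
    (by rw [mul_assoc, mul_smul, hy]), Matrix.mulVec_mulVec]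
  have : φ.rep * (φ.rep⁻¹ * μ * φ.rep) = μ * φ.rep := by group
  exact congrArg (fun A => rmat A *ᵥ ξ.1 y) this

/-- Conjugation by the frame g turns η(gsg⁻¹) into η(s), which acts on ℝ⁴ as v ↦ p v q̄. The factor
μ allows for the representative of φ being determined only up to Γ. -/
theorem det_id_sub_differential {φ : X.SpinSymmetry} (hP : φ.base P = P) {g : SU11}
    (hg : X.pt (eta g • basePt) = P) {s : Spin4} {p q : ℍ[ℝ]} (hs : mat s = !![p, 0; 0, q])
    (hφ : ∃ μ ∈ X.Γ, eta (g * s * g⁻¹) = μ * φ.rep) :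
    LinearMap.det (LinearMap.id - differential φ hP) = (1 - rotMat p q).det := by
  have hfix : eta (g * s * g⁻¹) • eta g • basePt = eta g • basePt := by
    have : eta (s : SU11) • basePt = basePt := s.2
    rw [map_mul, map_mul, map_inv, mul_smul, inv_smul_smul, mul_smul, this]
  have hc : (tangentEquiv (eta g) hg).conj (LinearMap.id - differential φ hP) =
      Matrix.toLin' (1 - rotMat p q) := by
    refine LinearMap.ext fun w => ?_
    obtain ⟨ξ, rfl⟩ := (tangentEquiv (eta g) hg).surjective w
    rw [LinearEquiv.conj_apply_apply, LinearEquiv.symm_apply_apply, Matrix.toLin'_apply,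
      LinearMap.sub_apply, LinearMap.id_apply, map_sub, Matrix.sub_mulVec, Matrix.one_mulVec]
    congr 1
    refine funext fun i => ?_
    change (rmat (eta g)⁻¹ *ᵥ (differential φ hP ξ).1 ⟨eta g • basePt, hg⟩) i.castSucc = _
    rw [differential_apply hP ⟨eta g • basePt, hg⟩ hφ hfix]
    have e : rmat (eta (g * s * g⁻¹)) = rmat (eta g) * (etaMat !![p, 0; 0, q] * rmat (eta g)⁻¹) := by
      rw [← hs, map_mul, map_mul, map_inv, mul_assoc]
      rfl
    rw [e, ← Matrix.mulVec_mulVec, rmat_inv_mulVec_rmat, ← Matrix.mulVec_mulVec,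
      etaMat_diag_mulVec_castSucc]
    rfl
  rw [← LinearMap.det_toLin', ← hc]
  exact (LinearMap.det_conj (LinearMap.id - differential φ hP) (tangentEquiv (eta g) hg)).symm

end Tangent

end SpinClosedHyperbolic4

/-! ### Isolated fixed points and fixed geodesics -/

theorem continuous_smul_H4 (g : SOplus) : Continuous fun y : H4 => g • y :=
  Continuous.subtype_mk (continuous_const.matrix_mulVec continuous_subtype_val) _

/-- A point of the geodesic through `e₅` in the direction of the vector `v` of `ℝ⁴`. -/
noncomputable def geodesicPt (v : Fin 4 → ℝ) (t : ℝ) : H4 :=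
  ⟨![t * v 0, t * v 1, t * v 2, t * v 3, √(1 + t ^ 2 * (v 0 ^ 2 + v 1 ^ 2 + v 2 ^ 2 + v 3 ^ 2))], by
    have h : 0 < 1 + t ^ 2 * (v 0 ^ 2 + v 1 ^ 2 + v 2 ^ 2 + v 3 ^ 2) := by positivity
    refine ⟨?_, Real.sqrt_pos.mpr h⟩
    have := Real.mul_self_sqrt h.le
    simp only [lor, Matrix.cons_val]
    rw [this]
    ring⟩

theorem geodesicPt_castSucc (v : Fin 4 → ℝ) (t : ℝ) (i : Fin 4) :
    (geodesicPt v t).1 i.castSucc = t * v i := by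
  fin_cases i <;> rfl

theorem geodesicPt_zero (v : Fin 4 → ℝ) : geodesicPt v 0 = basePt := by
  refine Subtype.ext (funext fun i => ?_)
  fin_cases i <;> simp [geodesicPt, basePt]

theorem continuous_geodesicPt (v : Fin 4 → ℝ) : Continuous (geodesicPt v) := by
  refine Continuous.subtype_mk (continuous_pi fun i => ?_) _
  fin_cases i <;> simp <;> fun_prop

theorem geodesicPt_injective {v : Fin 4 → ℝ} (hv : v ≠ 0) : Function.Injective (geodesicPt v) := by
  obtain ⟨i, hi⟩ := Function.ne_iff.mp hv
  intro s t h
  have := congrFun (congrArg Subtype.val h) i.castSucc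
  rw [geodesicPt_castSucc, geodesicPt_castSucc] at this
  exact mul_right_cancel₀ hi this

/-- The last coordinate is untouched by η(diag(p, q)), and the first four form the multiple tv of a
fixed vector. -/
theorem eta_smul_geodesicPt {A : SU11} {p q : ℍ[ℝ]} (hA : mat A = !![p, 0; 0, q]) (hp : ‖p‖ = 1)
    {v : Fin 4 → ℝ} (hv : rotMat p q *ᵥ v = v) (t : ℝ) :
    eta A • geodesicPt v t = geodesicPt v t := by
  refine Subtype.ext (funext fun i => ?_)
  change (etaMat (mat A) *ᵥ (geodesicPt v t).1) i = _
  rw [hA]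
  induction i using Fin.lastCases with
  | last => exact etaMat_diag_mulVec_last hp _
  | cast i =>
    have : (fun j : Fin 4 => (geodesicPt v t).1 j.castSucc) = t • v :=
      funext fun j => geodesicPt_castSucc v t j
    rw [etaMat_diag_mulVec_castSucc, this, Matrix.mulVec_smul, hv, geodesicPt_castSucc]
    rfl

namespace SpinClosedHyperbolic4

variable {X : SpinClosedHyperbolic4}

theorem continuous_pt : Continuous X.pt := continuous_quotient_mk'

/-- A discrete subspace of a second countable space is countable. This makes the fibres of H⁴ → M
countable. -/
theorem countable_Γ (X : SpinClosedHyperbolic4) : Countable X.Γ := by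
  have := X.discrete
  have : SecondCountableTopology (Matrix (Fin 5) (Fin 5) ℝ) :=
    inferInstanceAs (SecondCountableTopology (Fin 5 → Fin 5 → ℝ))
  have : SecondCountableTopology (Matrix.SpecialLinearGroup (Fin 5) ℝ) :=
    Topology.IsInducing.secondCountableTopology (f := Subtype.val) ⟨rfl⟩
  exact countable_of_Lindelof_of_discrete

/-- At an isolated fixed point `Γ(ge₅)`, the rotation by which the isometry acts on the tangent space
has no nonzero fixed vector. -/
theorem re_ne_re_of_isolated {φ : X.SpinSymmetry} {P : X.M}
    (hiso : ∀ᶠ Q in 𝓝[≠] P, φ.base Q ≠ Q) {g : SOplus} (hg : X.pt (g • basePt) = P)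
    {A : SU11} {p q : ℍ[ℝ]} (hA : mat A = !![p, 0; 0, q]) (hp : ‖p‖ = 1) (hq : ‖q‖ = 1)
    (hφ : ∀ y, φ.base (X.pt (g • y)) = X.pt (g • eta A • y)) : p.re ≠ q.re := by
  intro hpq
  have hdet : (1 - rotMat p q).det = 0 := by rw [det_one_sub_rotMat hp hq, hpq]; ring
  obtain ⟨v, hv0, hv⟩ := Matrix.exists_mulVec_eq_zero_iff.mpr hdet
  rw [Matrix.sub_mulVec, Matrix.one_mulVec, sub_eq_zero] at hv
  let c : ℝ → H4 := fun t => g • geodesicPt v t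
  have hc : Continuous c := (continuous_smul_H4 g).comp (continuous_geodesicPt v)
  have hinj : Function.Injective c :=
    (MulAction.injective g).comp (geodesicPt_injective hv0)
  have hc0 : X.pt (c 0) = P := by rw [← hg, ← geodesicPt_zero v]
  have hfix : ∀ t, φ.base (X.pt (c t)) = X.pt (c t) := fun t => by
    rw [hφ, eta_smul_geodesicPt hA hp hv.symm]
  -- For small t the point of M under c(t) is a fixed point close to P, and isolation leaves only P
  -- itself.
  have hev : ∀ᶠ t in 𝓝 (0 : ℝ), X.pt (c t) = P := by
    have ht : Filter.Tendsto (fun t => X.pt (c t)) (𝓝 0) (𝓝 P) := by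
      rw [← hc0]
      exact (continuous_pt.comp hc).tendsto 0
    filter_upwards [ht.eventually (eventually_nhdsWithin_iff.mp hiso)] with t h
    by_contra hne
    exact h hne (hfix t)
  have := X.countable_Γ
  -- The points of the curve over P lie in the countable orbit Γc(0), and c is injective. A
  -- countable set of parameters has dense complement in ℝ, so it cannot contain a neighbourhood of
  -- 0.
  have hcount : {t | X.pt (c t) = P}.Countable := by
    refine ((Set.countable_range fun γ : X.Γ => (γ : SOplus) • c 0).preimage hinj).mono ?_
    intro t ht
    obtain ⟨γ, hγ, h⟩ := X.pt_eq_iff.mp ((show X.pt (c t) = P from ht).trans hc0.symm)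
    exact ⟨⟨γ, hγ⟩, h⟩
  obtain ⟨t, h1, h2⟩ := (hcount.dense_compl ℝ).inter_nhds_nonempty hev
  exact h1 h2

end SpinClosedHyperbolic4

end SpinHyp

/-! ### The formula for the contribution of P -/

open SpinHyp in
theorem theorem7p3 (X : SpinClosedHyperbolic4) (φ : X.SpinSymmetry)
    (f : SOplus) (hf : ∀ y : H4, φ.base (X.pt y) = X.pt (f • y))
    (fh : SU11) (hfh : eta fh = f)
    (hφ : ∀ h : SU11, φ.bundleMap (X.spinPt h) = X.spinPt (fh * h))
    (P : X.M) (hP : φ.base P = P)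
    (hiso : Filter.Eventually (fun Q => φ.base Q ≠ Q) (nhdsWithin P {P}ᶜ))
    (x : H4) (hx : X.pt x = P)
    (g : SOplus) (hg : g • basePt = x) (gh : SU11) (hgh : eta gh = g)
    (γ : SOplus) (hγ : γ ∈ X.Γ) (hγx : γ • f • x = x)
    (γh : SU11) (hγh : γh ∈ X.Γh) (hγη : eta γh = γ) :
    ∃ p q : Quaternion ℝ, ‖p‖ = 1 ∧ ‖q‖ = 1 ∧
      mat (gh⁻¹ * γh * fh * gh) = !![p, 0; 0, q] ∧
      p.re ≠ q.re ∧
      SpinClosedHyperbolic4.nu φ P hP = ((1 / (2 * (p.re - q.re)) : ℝ) : ℂ) := by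
  subst hfh hgh hγη hg
  have hmem : gh⁻¹ * γh * fh * gh ∈ Spin4 := by
    change eta (gh⁻¹ * γh * fh * gh) • basePt = basePt
    rw [map_mul, map_mul, map_mul, map_inv, mul_smul, mul_smul, mul_smul, hγx, inv_smul_smul]
  obtain ⟨p, q, hp, hq, hs⟩ := mat_eq_diag_of_mem_Spin4 hmem
  have hne : p.re ≠ q.re := by
    refine SpinClosedHyperbolic4.re_ne_re_of_isolated hiso hx hs hp hq fun y => ?_
    rw [hf]
    -- In the frame g the rotation represents γf rather than f. The two differ by γ and induce the
    -- same map on M.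
    refine X.pt_eq_iff.mpr ⟨(eta γh)⁻¹, inv_mem hγ, ?_⟩
    simp only [map_mul, map_inv, mul_smul, smul_inv_smul, inv_smul_smul]
  refine ⟨p, q, hp, hq, hs, hne, ?_⟩
  have hu : φ.bundleMap (X.spinPt gh) = X.rmul ⟨_, hmem⟩ (X.spinPt gh) := by
    rw [hφ]
    exact X.spinPt_eq_iff.mpr ⟨γh⁻¹, inv_mem hγh, by group⟩
  have hrep : ∃ μ ∈ X.Γ, eta (gh * (gh⁻¹ * γh * fh * gh) * gh⁻¹) = μ * φ.rep := by
    -- The differential is built from a chosen representative of φ̂, not from f̂. Evaluating the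
    -- bundle map at the class of 1 shows that the two differ by some ν in Γ̂.
    have h1 := (hφ 1).symm.trans (φ.exists_rep.choose_spec.2.1 1)
    rw [mul_one, mul_one] at h1
    obtain ⟨ν, hν, h⟩ := X.spinPt_eq_iff.mp h1
    refine ⟨eta (γh * ν), X.lift.mapsTo (mul_mem hγh hν), ?_⟩
    rw [SpinClosedHyperbolic4.SpinSymmetry.rep, ← map_mul, mul_assoc γh, h]
    congr 1
    group
  rw [SpinClosedHyperbolic4.nu,
    SpinClosedHyperbolic4.trace_spinorAction_one ⟨X.spinPt gh, hx⟩ hP (s := ⟨_, hmem⟩) hu hs,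
    SpinClosedHyperbolic4.trace_spinorAction_neg_one ⟨X.spinPt gh, hx⟩ hP (s := ⟨_, hmem⟩) hu hs,
    SpinClosedHyperbolic4.det_id_sub_differential hP hx (s := ⟨_, hmem⟩) hs hrep,
    det_one_sub_rotMat hp hq, abs_of_nonneg (by positivity)]
  -- What is left is (2Re(p) - 2Re(q)) / (4(Re(p) - Re(q))²), where one factor cancels.
  have h0 : p.re - q.re ≠ 0 := sub_ne_zero.mpr hne
  norm_cast
  field_simp
  norm_num
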